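/- Let $\Bbbk$ be a field, $R$ a commutative $\Bbbk$-algebra, $n\ge 1$, $\sigma_1,\dots,\sigma_n$ commuting $\Bbbk$-algebra automorphisms of $R$, and $(p_{ij})\in M_n(\Bbbk^\times)$ with $p_{ij}=p_{ji}^{-1}$ for all $i,j$. Let $R_{\mathbf p}[\mathbf t^{\pm1};\boldsymbol\sigma]$ be the iterated skew Laurent extension: it is generated over $R$ by $t_1^{\pm1},\dots,t_n^{\pm1}$ with $t_i^{\pm1}r=\sigma_i^{\pm1}(r)t_i^{\pm1}$ for $r\in R$ and $t_jt_i=p_{ij}t_it_j$ for $i\neq j$, and it is free as a left $R$-module on the monomials $\mathbf t^{\alpha}=t_1^{\alpha_1}\cdots t_n^{\alpha_n}$, $\alpha\in\mathbb Z^n$. Let $H_1,\dots,H_n$ and $J_1,\dots,J_n$ be ideals of $R$ with $\sigma_i(H_j)=H_j$ and $\sigma_i(J_j)=J_j$ for $i\ne j$. Put $I_i^{(a)}=J_i\sigma_i(J_i)\cdots\sigma_i^{a-1}(J_i)$ for $a>0$, $I_i^{(0)}=R$, and $I_i^{(a)}=\sigma_i^{-1}(H_i)\sigma_i^{-2}(H_i)\cdots\sigma_i^{a}(H_i)$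 for $a<0$, and assume that $I_i^{(a)}\neq0$ for all $i$ and all $a\in\mathbb Z$. The corresponding Bell--Rogalski algebra is $$B=\bigoplus_{\alpha\in\mathbb Z^n}I_1^{(\alpha_1)}\cdots I_n^{(\alpha_n)}\,\mathbf t^{\alpha}\ \subseteq\ R_{\mathbf p}[\mathbf t^{\pm1};\boldsymbol\sigma].$$ A left $B$-module $M$ is a weight module if $M=\bigoplus_{\mathfrak m\in\operatorname{Maxspec}(R)}M_{\mathfrak m}$, where $M_{\mathfrak m}=\{x\in M:\mathfrak m x=0\}$; its support is $\operatorname{supp}(M)=\{\mathfrak m: M_{\mathfrak m}\ne0\}$. The group $\mathbb Z^n$ acts on $\operatorname{Maxspec}(R)$ by $\alpha\cdot\mathfrak m=\sigma_1^{\alpha_1}\cdots\sigma_n^{\alpha_n}(\mathfrak m)$. Let $\mathcal O$ be a torsion-free orbit, that is, for $\mathfrak m\in\mathcal O$, $\alpha\cdot\mathfrak m=\mathfrak m$ implies $\alpha=0$. For each $i$: - let $\beta_i$ be the set of $i$-breaks in $\mathcal O$, i.e. of those $\mathfrak m\in\mathcal O$ with $H_iJ_i\subseteq\sigma_i(\mathfrak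 m)$, and let $\overline\beta_i$ be the set of orbits $[\mathfrak m]$ in $\beta_i$ of $\Gamma_i=\langle\sigma_j: j\ne i\rangle$; - let $\prec_i$ be the partial order on $\mathcal O$ generated by $\mathfrak m\prec_i\sigma_i(\mathfrak m)$, and order $\overline\beta_i$ totally by: $[\mathfrak m]\prec_i[\mathfrak n]$ if $\gamma_1(\mathfrak m)\prec_i\gamma_2(\mathfrak n)$ for some $\gamma_1,\gamma_2\in\Gamma_i$; - let $\overline\beta{}'_i=\overline\beta_i\cup\{\infty_i\}$ if $\overline\beta_i$ is empty or has a maximal element, and $\overline\beta{}'_i=\overline\beta_i$ otherwise, where $\infty_i$ is larger than all elements of $\overline\beta_i$; - for $x\in\overline\beta{}'_i$ let $x^-$ be the maximal element of $\{y\in\overline\beta{}'_i: y\prec_i x\}$, and $x^-=-\infty_i$ if $x$ is minimal; - for $\mathfrak m\in\mathcal O$ write $\mathfrak m\preceq_i[\mathfrak n]$ (resp. $[\mathfrak n]\prec_i\mathfrak m$) if $\mathfrak m\preceq_i\gamma(\mathfrak n)$ (resp. $\gamma(\mathfrak n)\prec_i\mathfrak m$) for some $\gamma\in\Gamma_i$;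 moreover $-\infty_i\prec_i\mathfrak m\prec_i\infty_i$. Then the isomorphism classes of simple weight $B$-modules $M$ with $\operatorname{supp}(M)\subseteq\mathcal O$ are in bijection with $\prod_{i=1}^n\overline\beta{}'_i$. Under this bijection, the class of $M$ corresponds to the unique tuple $(x_1,\dots,x_n)\in\prod_{i=1}^n\overline\beta{}'_i$ such that $$\operatorname{supp}(M)=\{\mathfrak m\in\mathcal O:\ x_i^-\prec_i\mathfrak m\preceq_i x_i\ \text{ for all } i=1,\dots,n\}.$$ -/

import Mathlib

open scoped Pointwise DirectSum

universe u v w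

noncomputable section

/-- The data of an iterated skew Laurent extension of a commutative `k`-algebra `R`: commuting
`k`-algebra automorphisms `σ_1, …, σ_n` and a multiplicatively antisymmetric matrix `p`. -/
structure SkewLaurentDatum (k : Type u) [Field k] (R : Type v) [CommRing R] [Algebra k R]
    (n : ℕ) where
  σ : Fin n → (R ≃ₐ[k] R)
  σ_comm : ∀ i j, Commute (σ i) (σ j)
  p : Fin n → Fin n → kˣ
  p_antisymm : ∀ i j, p i j = (p j i)⁻¹

namespace SkewLaurentDatum

variable {k : Type u} [Field k] {R : Type v} [CommRing R] [Algebra k R] {n : ℕ}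
  (S : SkewLaurentDatum k R n)

/-- `σ^α = σ_1^{α_1} ⋯ σ_n^{α_n}`; the factors commute. -/
def sig (α : Fin n → ℤ) : R ≃ₐ[k] R :=
  Finset.univ.noncommProd (fun i => S.σ i ^ α i)
    (fun i _ j _ _ => ((S.σ_comm i j).zpow_zpow (α i) (α j)))

/-- The scalar with `t^α t^β = cocycle α β • t^{α+β}` where `t^α = t_1^{α_1} ⋯ t_n^{α_n}`:
for `i < j`, moving `t_j^{α_j}` to the right of `t_i^{β_i}` produces `p_{ij}^{α_j β_i}`. -/
def cocycle (α β : Fin n → ℤ) : kˣ :=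
  ∏ i, ∏ j, if i < j then S.p i j ^ (α j * β i) else 1

theorem sig_zero : S.sig 0 = 1 := by
  unfold sig
  exact (Finset.noncommProd_eq_pow_card _ _ _ 1 (by simp)).trans (one_pow _)

theorem sig_add (α β : Fin n → ℤ) : S.sig (α + β) = S.sig α * S.sig β := by
  unfold sig
  refine Eq.trans ?_ (Finset.noncommProd_mul_distrib _ _ _ _
    (fun i _ j _ _ => (S.σ_comm i j).zpow_zpow (β i) (α j)))
  exact Finset.noncommProd_congr rfl (fun i _ => zpow_add _ _ _) _

theorem sig_single (i : Fin n) (a : ℤ) : S.sig (Pi.single i a) = S.σ i ^ a := by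
  have h : ∀ (s : Finset (Fin n)) (hc), s.noncommProd
      (fun j => S.σ j ^ (Pi.single i a : Fin n → ℤ) j) hc = if i ∈ s then S.σ i ^ a else 1 := by
    intro s
    induction s using Finset.induction_on with
    | empty => intro hc; simp
    | insert j s hj ih =>
      intro hc
      rw [Finset.noncommProd_insert_of_notMem _ _ _ _ hj, ih]
      by_cases hij : i = j
      · subst hij; simp [hj]
      · simp [hij]
  exact (h Finset.univ _).trans (if_pos (Finset.mem_univ i))

theorem cocycle_zero_left (β : Fin n → ℤ) : S.cocycle 0 β = 1 := by simp [cocycle]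

theorem cocycle_zero_right (α : Fin n → ℤ) : S.cocycle α 0 = 1 := by simp [cocycle]

theorem cocycle_add_left (α β γ : Fin n → ℤ) :
    S.cocycle (α + β) γ = S.cocycle α γ * S.cocycle β γ := by
  simp only [cocycle, ← Finset.prod_mul_distrib]
  refine Finset.prod_congr rfl fun i _ => Finset.prod_congr rfl fun j _ => ?_
  split_ifs <;> simp [add_mul, zpow_add]

theorem cocycle_add_right (α β γ : Fin n → ℤ) :
    S.cocycle α (β + γ) = S.cocycle α β * S.cocycle α γ := by
  simp only [cocycle, ← Finset.prod_mul_distrib]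
  refine Finset.prod_congr rfl fun i _ => Finset.prod_congr rfl fun j _ => ?_
  split_ifs <;> simp [mul_add, zpow_add]

/-- The degree `α` component `R t^α` of the skew Laurent extension: a copy of `R`. -/
def Comp (_ : SkewLaurentDatum k R n) (_ : Fin n → ℤ) : Type v := R

instance (α : Fin n → ℤ) : AddCommGroup (S.Comp α) := inferInstanceAs (AddCommGroup R)

instance (α : Fin n → ℤ) : Module k (S.Comp α) := inferInstanceAs (Module k R)

/-- The identification `R t^α = R`. -/
def cf (α : Fin n → ℤ) : S.Comp α ≃ₗ[k] R := LinearEquiv.refl k R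

instance : GradedMonoid.GOne S.Comp := ⟨(S.cf 0).symm 1⟩

/-- `(r t^α)(s t^β) = r σ^α(s) t^α t^β = (cocycle α β • r σ^α(s)) t^{α+β}`. -/
instance : GradedMonoid.GMul S.Comp where
  mul {α β} r s := (S.cf (α + β)).symm
    (((S.cocycle α β : kˣ) : k) • (S.cf α r * S.sig α (S.cf β s)))

theorem cf_mul {α β : Fin n → ℤ} (r : S.Comp α) (s : S.Comp β) :
    S.cf (α + β) (GradedMonoid.GMul.mul r s)
      = ((S.cocycle α β : kˣ) : k) • (S.cf α r * S.sig α (S.cf β s)) := rfl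

theorem cf_one : S.cf 0 GradedMonoid.GOne.one = 1 := rfl

theorem mk_eq (x y : GradedMonoid S.Comp) (h : x.1 = y.1) (h' : S.cf x.1 x.2 = S.cf y.1 y.2) :
    x = y := by
  obtain ⟨α, x⟩ := x
  obtain ⟨β, y⟩ := y
  change α = β at h
  subst h
  exact congrArg _ ((S.cf α).injective h')

instance : DirectSum.GRing S.Comp where
  mul_zero {α β} a := (S.cf _).injective (by rw [cf_mul]; simp)
  zero_mul {α β} a := (S.cf _).injective (by rw [cf_mul]; simp)
  mul_add {α β} a b c := (S.cf _).injective (by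
    rw [map_add, cf_mul, cf_mul, cf_mul, map_add, map_add, mul_add, smul_add])
  add_mul {α β} a b c := (S.cf _).injective (by
    rw [map_add, cf_mul, cf_mul, cf_mul, map_add, add_mul, smul_add])
  one_mul a := S.mk_eq _ _ (zero_add a.1) ((S.cf_mul _ a.2).trans (by
    change ((S.cocycle 0 a.1 : kˣ) : k) • ((1 : R) * S.sig 0 (S.cf a.1 a.2)) = _
    rw [cocycle_zero_left, sig_zero]; simp))
  mul_one a := S.mk_eq _ _ (add_zero a.1) ((S.cf_mul a.2 _).trans (by
    change ((S.cocycle a.1 0 : kˣ) : k) • (S.cf a.1 a.2 * S.sig a.1 1) = _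
    rw [cocycle_zero_right]; simp))
  mul_assoc a b c := S.mk_eq _ _ (add_assoc a.1 b.1 c.1) (by
    change ((S.cocycle (a.1 + b.1) c.1 : kˣ) : k) •
        (((S.cocycle a.1 b.1 : kˣ) : k) • (S.cf a.1 a.2 * S.sig a.1 (S.cf b.1 b.2))
          * S.sig (a.1 + b.1) (S.cf c.1 c.2))
      = ((S.cocycle a.1 (b.1 + c.1) : kˣ) : k) • (S.cf a.1 a.2 *
          S.sig a.1 (((S.cocycle b.1 c.1 : kˣ) : k) •
            (S.cf b.1 b.2 * S.sig b.1 (S.cf c.1 c.2))))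
    rw [cocycle_add_left, cocycle_add_right, sig_add, map_smul, map_mul, AlgEquiv.mul_apply]
    simp only [smul_mul_assoc, mul_smul_comm, smul_smul, Units.val_mul, mul_assoc]
    congr 1
    ring)
  natCast m := (S.cf 0).symm m
  natCast_zero := by simp
  natCast_succ m := by rw [Nat.cast_succ, map_add]; rfl
  intCast m := (S.cf 0).symm m
  intCast_ofNat m := by rw [Int.cast_natCast]
  intCast_negSucc_ofNat m := by rw [Int.cast_negSucc, map_neg]

instance : DirectSum.GAlgebra k S.Comp where
  toFun := ((S.cf 0).symm : R →+ S.Comp 0).comp (algebraMap k R : k →+ R)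
  map_one := congrArg (S.cf 0).symm (map_one (algebraMap k R))
  map_mul r s := S.mk_eq _ _ (zero_add 0).symm (by
    change algebraMap k R (r * s) = ((S.cocycle 0 0 : kˣ) : k) •
      (algebraMap k R r * S.sig 0 (algebraMap k R s))
    rw [cocycle_zero_left]; simp)
  commutes r x := S.mk_eq _ _ ((zero_add x.1).trans (add_zero x.1).symm) (by
    change ((S.cocycle 0 x.1 : kˣ) : k) • (algebraMap k R r * S.sig 0 (S.cf x.1 x.2))
      = ((S.cocycle x.1 0 : kˣ) : k) • (S.cf x.1 x.2 * S.sig x.1 (algebraMap k R r))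
    rw [cocycle_zero_left, cocycle_zero_right, sig_zero]
    simp [mul_comm])
  smul_def r x := S.mk_eq _ _ (zero_add x.1).symm (by
    change r • S.cf x.1 x.2
      = ((S.cocycle 0 x.1 : kˣ) : k) • (algebraMap k R r * S.sig 0 (S.cf x.1 x.2))
    rw [cocycle_zero_left, sig_zero]
    simp [Algebra.smul_def])

/-- The iterated skew Laurent extension `R_p[t^{±1}; σ] = ⨁_α R t^α`, a `k`-algebra. -/
abbrev SkewLaurent : Type v := ⨁ α, S.Comp α

/-- The element `r t^α`. -/
def mono (α : Fin n → ℤ) (r : R) : S.SkewLaurent := DirectSum.of S.Comp α ((S.cf α).symm r)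

/-- The coefficient of `t^α`. -/
def coeff (α : Fin n → ℤ) : S.SkewLaurent →+ R :=
  ((S.cf α : S.Comp α →ₗ[k] R).toAddMonoidHom).comp (DirectSum.component ℕ _ S.Comp α)

theorem coeff_mono (α β : Fin n → ℤ) (r : R) :
    S.coeff α (S.mono β r) = if α = β then r else 0 := by
  change S.cf α ((DirectSum.of S.Comp β ((S.cf β).symm r)) α) = _
  split_ifs with h
  · subst h; rw [DirectSum.of_eq_same]; simp
  · rw [DirectSum.of_eq_of_ne _ _ _ h]; simp

theorem eq_sum_mono (f : S.SkewLaurent) :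
    ∃ s : Finset (Fin n → ℤ), f = ∑ α ∈ s, S.mono α (S.coeff α f) := by
  classical
  refine ⟨DFinsupp.support f, ?_⟩
  conv_lhs => rw [← DirectSum.sum_support_of f]
  rfl

theorem mono_mul_mono (α β : Fin n → ℤ) (r s : R) :
    S.mono α r * S.mono β s
      = S.mono (α + β) (((S.cocycle α β : kˣ) : k) • (r * S.sig α s)) :=
  DirectSum.of_mul_of _ _

theorem mono_zero_one : S.mono 0 1 = 1 := rfl

theorem smul_mono (c : k) (α : Fin n → ℤ) (r : R) : c • S.mono α r = S.mono α (c • r) := by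
  unfold mono
  rw [map_smul, DirectSum.of_smul]

/-- The defining relation `t_i^{±1} r = σ_i^{±1}(r) t_i^{±1}`. -/
theorem t_mul_coeff (i : Fin n) (a : ℤ) (r : R) :
    S.mono (Pi.single i a) 1 * S.mono 0 r
      = S.mono 0 ((S.σ i ^ a) r) * S.mono (Pi.single i a) 1 := by
  rw [mono_mul_mono, mono_mul_mono, cocycle_zero_left, cocycle_zero_right, sig_single, sig_zero,
    add_zero, zero_add]
  simp

/-- `t_i^a t_i^b = t_i^{a+b}`; in particular `t_i t_i⁻¹ = t_i⁻¹ t_i = 1`. -/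
theorem t_mul_t_self (i : Fin n) (a b : ℤ) :
    S.mono (Pi.single i a) 1 * S.mono (Pi.single i b) 1 = S.mono (Pi.single i (a + b)) 1 := by
  have h : S.cocycle (Pi.single i a) (Pi.single i b) = 1 := by
    refine Finset.prod_eq_one fun x _ => Finset.prod_eq_one fun y _ => ?_
    split_ifs with hxy
    · by_cases hx : x = i
      · subst hx; simp [Pi.single_eq_of_ne hxy.ne']
      · simp [Pi.single_eq_of_ne hx]
    · rfl
  rw [mono_mul_mono, h, Pi.single_add]
  simp

theorem cocycle_single (i j : Fin n) :
    S.cocycle (Pi.single j 1) (Pi.single i 1) = if i < j then S.p i j else 1 := by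
  unfold cocycle
  rw [Finset.prod_eq_single i, Finset.prod_eq_single j]
  · simp
  · intro y _ hy; simp [Pi.single_eq_of_ne hy]
  · simp
  · intro x _ hx; simp [Pi.single_eq_of_ne hx]
  · simp

/-- The defining relation `t_j t_i = p_{ij} t_i t_j` for `i ≠ j`. -/
theorem t_mul_t (i j : Fin n) (hij : i ≠ j) :
    S.mono (Pi.single j 1) 1 * S.mono (Pi.single i 1) 1
      = ((S.p i j : kˣ) : k) • (S.mono (Pi.single i 1) 1 * S.mono (Pi.single j 1) 1) := by
  rw [mono_mul_mono, mono_mul_mono, cocycle_single, cocycle_single, smul_mono,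
    add_comm (Pi.single j 1) (Pi.single i 1)]
  rcases lt_or_gt_of_ne hij with h | h
  · simp [h, h.not_gt]
  · rw [S.p_antisymm i j]
    simp [h, h.not_gt, smul_smul]

end SkewLaurentDatum

/-- `I_σ^{(a)}(H, J)`: it is `J σ(J) ⋯ σ^{a-1}(J)` for `a > 0`, `R` for `a = 0`, and
`σ⁻¹(H) σ⁻²(H) ⋯ σ^{a}(H)` for `a < 0` (at most one of the two products is nonempty). -/
def brIdeal {k : Type u} [Field k] {R : Type v} [CommRing R] [Algebra k R]
    (σ : R ≃ₐ[k] R) (H J : Ideal R) (a : ℤ) : Ideal R :=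
  (∏ j ∈ Finset.Ico 0 a, (σ ^ j) • J) * ∏ j ∈ Finset.Ico a 0, (σ ^ j) • H

/-- A Bell--Rogalski datum over a commutative algebra `R`. As `R` is commutative, the ideals
`H_i`, `J_i` commute with each other, so this need not be required. -/
structure BRDatum (k : Type u) [Field k] (R : Type v) [CommRing R] [Algebra k R] (n : ℕ)
    extends SkewLaurentDatum k R n where
  H : Fin n → Ideal R
  J : Fin n → Ideal R
  σ_H : ∀ i j, i ≠ j → σ i • H j = H j
  σ_J : ∀ i j, i ≠ j → σ i • J j = J j
  I_ne_bot : ∀ i (a : ℤ), brIdeal (σ i) (H i) (J i) a ≠ ⊥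

namespace BRDatum

variable {k : Type u} [Field k] {R : Type v} [CommRing R] [Algebra k R] {n : ℕ}
  (D : BRDatum k R n)

/-- `I^{(α)} = I_1^{(α_1)} ⋯ I_n^{(α_n)}`. -/
def I (α : Fin n → ℤ) : Ideal R := ∏ i, brIdeal (D.σ i) (D.H i) (D.J i) (α i)

theorem prod_Ico_mul_le (f : ℤ → Ideal R) (a b c : ℤ) :
    (∏ j ∈ Finset.Ico a b, f j) * ∏ j ∈ Finset.Ico b c, f j ≤ ∏ j ∈ Finset.Ico a c, f j := by
  rw [← Finset.prod_union (Finset.Ico_disjoint_Ico_consecutive a b c)]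
  have hsub : Finset.Ico a c ⊆ Finset.Ico a b ∪ Finset.Ico b c := by
    intro x; simp only [Finset.mem_union, Finset.mem_Ico]; omega
  rw [← Finset.prod_sdiff hsub]
  exact mul_le_of_le_one_left' (Ideal.one_eq_top (R := R) ▸ le_top)

theorem smul_prod {ι : Type*} (g : R ≃ₐ[k] R) (s : Finset ι) (f : ι → Ideal R) :
    g • ∏ i ∈ s, f i = ∏ i ∈ s, g • f i :=
  map_prod (MulSemiringAction.toRingHom (R ≃ₐ[k] R) (Ideal R) g) f s

theorem zpow_smul_eq (g : R ≃ₐ[k] R) (L : Ideal R) (h : g • L = L) (a : ℤ) : g ^ a • L = L := by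
  have : g ∈ MulAction.stabilizer (R ≃ₐ[k] R) L := h
  exact (MulAction.stabilizer (R ≃ₐ[k] R) L).zpow_mem this a

theorem brIdeal_mul_le (σ : R ≃ₐ[k] R) (H J : Ideal R) (a b : ℤ) :
    brIdeal σ H J a * (σ ^ a • brIdeal σ H J b) ≤ brIdeal σ H J (a + b) := by
  have key : ∀ (L : Ideal R) (c d : ℤ), σ ^ a • ∏ j ∈ Finset.Ico c d, (σ ^ j) • L
      = ∏ j ∈ Finset.Ico (a + c) (a + d), (σ ^ j) • L := by
    intro L c d
    rw [smul_prod, ← Finset.map_add_left_Ico, Finset.prod_map]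
    simp [smul_smul, zpow_add]
  unfold brIdeal
  rw [smul_mul', key, key, add_zero, mul_mul_mul_comm,
    mul_comm (∏ j ∈ Finset.Ico a 0, (σ ^ j) • H)]
  exact mul_le_mul' (prod_Ico_mul_le _ _ _ _) (prod_Ico_mul_le _ _ _ _)

theorem sig_smul_brIdeal (α : Fin n → ℤ) (i : Fin n) (b : ℤ) :
    D.sig α • brIdeal (D.σ i) (D.H i) (D.J i) b
      = D.σ i ^ α i • brIdeal (D.σ i) (D.H i) (D.J i) b := by
  have fix : ∀ L : Ideal R, (∀ j, j ≠ i → D.σ j • L = L) →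
      ∀ (c : ℤ), D.sig α • (D.σ i ^ c • L) = D.σ i ^ α i • (D.σ i ^ c • L) := by
    intro L hL c
    have fixj : ∀ (j : Fin n), j ≠ i → D.σ j • (D.σ i ^ c • L) = D.σ i ^ c • L := by
      intro j hj
      rw [smul_smul, ((D.σ_comm j i).zpow_right c).eq, mul_smul, hL j hj]
    have hs : ∀ (s : Finset (Fin n)) (hc), s.noncommProd (fun j => D.σ j ^ α j) hc
        • (D.σ i ^ c • L) = if i ∈ s then D.σ i ^ α i • (D.σ i ^ c • L) else D.σ i ^ c • L := by
      intro s
      induction s using Finset.induction_on with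
      | empty => intro hc; simp
      | insert j s hj ih =>
        intro hc
        by_cases hij : i = j
        · subst hij
          rw [Finset.noncommProd_insert_of_notMem _ _ _ _ hj, mul_smul, ih]
          simp [hj]
        · rw [Finset.noncommProd_insert_of_notMem' _ _ _ _ hj, mul_smul,
            zpow_smul_eq _ _ (fixj j (Ne.symm hij)), ih]
          simp [hij]
    simpa [SkewLaurentDatum.sig] using hs Finset.univ _
  unfold brIdeal
  rw [smul_mul', smul_mul', smul_prod, smul_prod, smul_prod, smul_prod]
  congr 1
  · exact Finset.prod_congr rfl fun j _ => fix _ (fun l hl => D.σ_J l i hl) j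
  · exact Finset.prod_congr rfl fun j _ => fix _ (fun l hl => D.σ_H l i hl) j

theorem I_mul_le (α β : Fin n → ℤ) : D.I α * (D.sig α • D.I β) ≤ D.I (α + β) := by
  unfold I
  rw [smul_prod, ← Finset.prod_mul_distrib]
  refine Finset.prod_le_prod' fun i _ => ?_
  rw [sig_smul_brIdeal]
  exact brIdeal_mul_le _ _ _ _ _

theorem one_mem_I_zero : (1 : R) ∈ D.I 0 := by
  have : D.I 0 = 1 := by simp [I, brIdeal]
  rw [this]; exact Ideal.one_eq_top (R := R) ▸ Submodule.mem_top

theorem coeff_mono_mem {α : Fin n → ℤ} {r : R} (hr : r ∈ D.I α) (γ : Fin n → ℤ) :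
    D.coeff γ (D.mono α r) ∈ D.I γ := by
  rw [SkewLaurentDatum.coeff_mono]
  split_ifs with h
  · exact h ▸ hr
  · exact (D.I γ).zero_mem

theorem mem_I_zero (r : R) : r ∈ D.I 0 := by
  simpa using (D.I 0).mul_mem_left r D.one_mem_I_zero

/-- The Bell--Rogalski algebra `B = ⨁_α I^{(α)} t^α ⊆ R_p[t^{±1}; σ]`. -/
def B : Subalgebra k D.SkewLaurent where
  carrier := {f | ∀ α, D.coeff α f ∈ D.I α}
  add_mem' hf hg α := by rw [map_add]; exact (D.I α).add_mem (hf α) (hg α)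
  algebraMap_mem' c α := D.coeff_mono_mem (r := algebraMap k R c) (D.mem_I_zero _) α
  mul_mem' {f g} hf hg := by
    intro γ
    obtain ⟨s, hs⟩ := D.eq_sum_mono f
    obtain ⟨t, ht⟩ := D.eq_sum_mono g
    have hsum : f * g = ∑ α ∈ s, ∑ β ∈ t,
        D.mono α (D.coeff α f) * D.mono β (D.coeff β g) := by
      conv_lhs => rw [hs, ht]
      rw [Finset.sum_mul_sum]
    rw [hsum, map_sum]
    refine (D.I γ).sum_mem fun α _ => ?_
    rw [map_sum]
    refine (D.I γ).sum_mem fun β _ => ?_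
    rw [SkewLaurentDatum.mono_mul_mono]
    refine D.coeff_mono_mem ?_ γ
    rw [Algebra.smul_def]
    refine (D.I (α + β)).mul_mem_left _ (D.I_mul_le α β ?_)
    exact Ideal.mul_mem_mul (hf α) (Ideal.smul_mem_pointwise_smul (D.sig α) _ _ (hg β))

/-- The inclusion of `R` as the degree zero part of `B`. -/
def base : R →+* D.B where
  toFun r := ⟨D.mono 0 r, D.coeff_mono_mem (D.mem_I_zero r)⟩
  map_one' := rfl
  map_zero' := Subtype.ext (by simp [SkewLaurentDatum.mono])
  map_add' r s := Subtype.ext (by simp [SkewLaurentDatum.mono])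
  map_mul' r s := Subtype.ext (by
    change D.mono 0 (r * s) = D.mono 0 r * D.mono 0 s
    rw [SkewLaurentDatum.mono_mul_mono, SkewLaurentDatum.cocycle_zero_left,
      SkewLaurentDatum.sig_zero, add_zero]
    simp)

/-! ### The action of `ℤ^n` on the maximal spectrum -/

/-- `α · m = σ^α(m)`. -/
def act (α : Fin n → ℤ) (m : MaximalSpectrum R) : MaximalSpectrum R :=
  ⟨D.sig α • m.asIdeal, by
    have := m.isMaximal
    exact Ideal.map_isMaximal_of_equiv (D.sig α).toRingEquiv⟩

theorem act_zero (m : MaximalSpectrum R) : D.act 0 m = m := by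
  ext1; simp [act, SkewLaurentDatum.sig_zero]

theorem act_add (α β : Fin n → ℤ) (m : MaximalSpectrum R) :
    D.act (α + β) m = D.act α (D.act β m) := by
  ext1; simp [act, SkewLaurentDatum.sig_add, mul_smul]

/-- `O` is an orbit of the `ℤ^n`-action. -/
def IsOrbit (O : Set (MaximalSpectrum R)) : Prop := ∃ m, O = Set.range fun α => D.act α m

/-- `O` is torsion-free: all stabilizers of points of `O` are trivial. -/
def IsTorsionFree (O : Set (MaximalSpectrum R)) : Prop :=
  ∀ m ∈ O, ∀ α, D.act α m = m → α = 0

/-! ### Weight modules -/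

section Weight

variable (M : Type w) [AddCommGroup M] [Module D.B M]

/-- The weight space `M_m = {x ∈ M | m · x = 0}`. -/
def weightSpace (m : MaximalSpectrum R) : AddSubgroup M where
  carrier := {x | ∀ r ∈ m.asIdeal, D.base r • x = 0}
  zero_mem' r _ := smul_zero _
  add_mem' hx hy r hr := by rw [smul_add, hx r hr, hy r hr, add_zero]
  neg_mem' hx r hr := by rw [smul_neg, hx r hr, neg_zero]

open Classical in
/-- `M` is a weight module: `M = ⨁_m M_m`. -/
def IsWeightModule : Prop := DirectSum.IsInternal (D.weightSpace M)

/-- `supp(M) = {m | M_m ≠ 0}`. -/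
def supp : Set (MaximalSpectrum R) := {m | D.weightSpace M m ≠ ⊥}

end Weight

/-- The simple modules of the category of weight `B`-modules supported in `O`. -/
structure SimpleWeightModule (O : Set (MaximalSpectrum R)) where
  M : Type w
  [addCommGroup : AddCommGroup M]
  [module : Module D.B M]
  simple : IsSimpleModule D.B M
  weight : D.IsWeightModule M
  supp_subset : D.supp M ⊆ O

attribute [instance] SimpleWeightModule.addCommGroup SimpleWeightModule.module

/-- Isomorphism of `B`-modules. -/
instance isoSetoid (O : Set (MaximalSpectrum R)) :
    Setoid (SimpleWeightModule.{u, v, w} D O) where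
  r X Y := Nonempty (X.M ≃ₗ[D.B] Y.M)
  iseqv := ⟨fun _ => ⟨LinearEquiv.refl _ _⟩, fun ⟨e⟩ => ⟨e.symm⟩,
    fun ⟨e⟩ ⟨f⟩ => ⟨e.trans f⟩⟩

/-- The isomorphism classes of simple weight `B`-modules supported in `O`. -/
def SimpleIsoClass (O : Set (MaximalSpectrum R)) :=
  Quotient (isoSetoid.{u, v, w} D O)

/-! ### Breaks -/

variable (O : Set (MaximalSpectrum R)) (i : Fin n)

/-- `m` is an `i`-break: `σ_i(m) ⊇ H_i J_i`. -/
def IsBreak (m : MaximalSpectrum R) : Prop := D.H i * D.J i ≤ D.σ i • m.asIdeal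

/-- The set `β_i` of `i`-breaks in `O`. -/
def breaks : Set (MaximalSpectrum R) := {m | m ∈ O ∧ D.IsBreak i m}

/-- Equivalence of `i`-breaks under the group generated by the `σ_j`, `j ≠ i`, that is, under
those `σ^α` with `α_i = 0`. -/
instance breakSetoid : Setoid (D.breaks O i) where
  r m m' := ∃ α : Fin n → ℤ, α i = 0 ∧ D.act α m = m'
  iseqv := {
    refl := fun m => ⟨0, rfl, D.act_zero m⟩
    symm := by
      rintro m m' ⟨α, h, h'⟩
      refine ⟨-α, by simp [h], ?_⟩
      rw [← h', ← act_add, neg_add_cancel, act_zero]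
    trans := by
      rintro m m' m'' ⟨α, h, h'⟩ ⟨β, g, g'⟩
      refine ⟨β + α, by simp [h, g], ?_⟩
      rw [act_add, h', g'] }

/-- `β̄_i`, the set of hyperplanes of `i`-breaks. -/
def Hyper := Quotient (D.breakSetoid O i)

/-- The hyperplane `[m]` of an `i`-break `m`. -/
def hyper (b : D.breaks O i) : D.Hyper O i := Quotient.mk (D.breakSetoid O i) b

/-- `m ≺_i m'`, the transitive relation generated by `m ≺_i σ_i(m)`. -/
def Prec : MaximalSpectrum R → MaximalSpectrum R → Prop :=
  Relation.TransGen fun m m' => m' = D.act (Pi.single i 1) m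

/-- `[m] ≺_i [m']` if `γ₁(m) ≺_i γ₂(m')` for some `γ₁, γ₂` in the group generated by the `σ_j`,
`j ≠ i`; that is, if some representatives are so related. -/
instance hyperLT : LT (D.Hyper O i) where
  lt x y := ∃ b c : D.breaks O i, D.hyper O i b = x ∧ D.hyper O i c = y ∧ D.Prec i b c

/-- `β̄'_i`: it consists of `β̄_i`, together with `∞_i = ⊤` if `β̄_i` is empty or has a maximal
element. -/
def Hyper' : Type v :=
  {x : WithTop (D.Hyper O i) //
    x = ⊤ → IsEmpty (D.Hyper O i) ∨ ∃ b : D.Hyper O i, ∀ c, ¬ b < c}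

/-- The order on `β̄'_i`, with `∞_i` the largest element. -/
instance hyperLT' : LT (D.Hyper' O i) where
  lt x y := x.1 < y.1

open Classical in
/-- `x⁻`, the maximal element of `{y ∈ β̄'_i | y ≺_i x}`, or `-∞_i = ⊥` if there is none. -/
def pred (x : D.Hyper' O i) : WithBot (D.Hyper' O i) :=
  if h : ∃ y, y < x ∧ ∀ z, z < x → ¬ y < z then (h.choose : D.Hyper' O i) else ⊥

/-- `m ≼_i x` for a point `m` and `x ∈ β̄'_i`: here `m ≼_i ∞_i` always, and `m ≼_i [n]` if `m` equals
or precedes some point of `[n]`. -/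
def PointLE (m : MaximalSpectrum R) (x : D.Hyper' O i) : Prop :=
  x.1 = ⊤ ∨ ∃ b : D.breaks O i, x.1 = (D.hyper O i b : WithTop (D.Hyper O i)) ∧
    (m = b ∨ D.Prec i m b)

/-- `y ≺_i m` for `y ∈ β̄'_i ∪ {-∞_i}` and a point `m`: here `-∞_i ≺_i m` always, `∞_i ≺_i m` never,
and `[n] ≺_i m` if some point of `[n]` strictly precedes `m`. -/
def PointGT (y : WithBot (D.Hyper' O i)) (m : MaximalSpectrum R) : Prop :=
  y = ⊥ ∨ ∃ (x : D.Hyper' O i) (b : D.breaks O i), y = (x : WithBot (D.Hyper' O i)) ∧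
    x.1 = (D.hyper O i b : WithTop (D.Hyper O i)) ∧ D.Prec i b m

/-- The box `{m ∈ O | [n_i]⁻ ≺_i m ≼_i [n_i] for all i}` of a tuple of hyperplanes. -/
def box (N : ∀ i, D.Hyper' O i) : Set (MaximalSpectrum R) :=
  {m | m ∈ O ∧ ∀ i, D.PointGT O i (D.pred O i (N i)) m ∧ D.PointLE O i m (N i)}

end BRDatum

end

/-!
Fix a point `m` of the torsion-free orbit `O`. The left ideal
`L_m = {b ∈ B | (b' b)_0 ∈ m for all b' ∈ B}` controls the simple weight modules with `m` in their
support. Since the stabilizer of `m` is trivial, the homogeneous components of an element of `B`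
move a vector `x` of weight `m` to vectors of pairwise different weights, and weights can be
separated by elements of `R`. Therefore `b x = 0` forces `b_0 ∈ m`, so that the annihilator of a
nonzero `x ∈ M_m` is contained in `L_m`; when `M` is simple the two are equal by maximality, and
`M ≅ B / L_m` (`BRDatum.nonempty_linearEquiv_quotient`). Conversely `L_m` is a maximal left ideal
(`BRDatum.annIdeal_isMaximal`), and `B / L_m` is a simple weight module supported in `O`
(`BRDatum.exists_simpleWeightModule`). So each point of `O` lies in the support of exactly one
simple weight module up to isomorphism.

The support of this module is read off from `L_m`: it contains `σ^α(m)` if and only if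
`I^{(-α)} σ^{-α}(I^{(α)})` is not contained in `m` (`BRDatum.act_mem_supp_iff`). This ideal is a
product of translates of the `H_i J_i`, and `m` is prime, so the condition says that no break
separates `m` from `σ^α(m)` (`BRDatum.I_neg_mul_sig_smul_I_le_iff`).

Whether `σ^α(m)` is an `i`-break depends only on `α_i`, because `σ_j` fixes `H_i` and `J_i` for
`j ≠ i`. The hyperplanes of `i`-breaks thus form a subset `T_i` of `ℤ`, and the box of a tuple is a
product of intervals cut out of `ℤ` by the `T_i` (`BRDatum.act_mem_box_iff`). These intervals are
nonempty, partition `ℤ`, and consist of the integers not separated by elements of `T_i`; hence the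
supports of the simple weight modules are exactly the boxes (`BRDatum.supp_eq_box`).
-/

/-! ### Coefficients of products -/

namespace SkewLaurentDatum

variable {k : Type u} [Field k] {R : Type v} [CommRing R] [Algebra k R] {n : ℕ}
  (S : SkewLaurentDatum k R n)

theorem mono_zero (α : Fin n → ℤ) : S.mono α 0 = 0 := by simp [mono]

theorem mono_induction {p : S.SkewLaurent → Prop} (f : S.SkewLaurent)
    (hm : ∀ α r, p (S.mono α r)) (ha : ∀ f g, p f → p g → p (f + g)) : p f := by
  obtain ⟨s, hs⟩ := S.eq_sum_mono f
  rw [hs]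
  refine Finset.sum_induction _ p ha ?_ fun α _ => hm α _
  rw [← S.mono_zero 0]
  exact hm 0 0

theorem coeff_mul_mono (f : S.SkewLaurent) (α γ : Fin n → ℤ) (r : R) :
    S.coeff (γ + α) (f * S.mono α r)
      = ((S.cocycle γ α : kˣ) : k) • (S.coeff γ f * S.sig γ r) := by
  induction f using S.mono_induction with
  | hm β s =>
    rw [mono_mul_mono, coeff_mono, coeff_mono]
    by_cases h : γ = β
    · subst h; simp
    · simp [h]
  | ha f g hf hg => rw [add_mul, map_add, map_add, hf, hg, add_mul, smul_add]

end SkewLaurentDatum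

namespace BRDatum

variable {k : Type u} [Field k] {R : Type v} [CommRing R] [Algebra k R] {n : ℕ}
  (D : BRDatum k R n)

/-! ### Homogeneous elements -/

/-- The element `r t^α` of `B`, for `r ∈ I^{(α)}`. -/
def homog (α : Fin n → ℤ) (r : D.I α) : D.B := ⟨D.mono α r, D.coeff_mono_mem r.2⟩

/-- The homogeneous component of degree `α` of an element of `B`. -/
def component (α : Fin n → ℤ) (b : D.B) : D.B := D.homog α ⟨D.coeff α b.1, b.2 α⟩

theorem component_zero (b : D.B) : D.component 0 b = D.base (D.coeff 0 b.1) := rfl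

theorem exists_eq_component_add_sum (γ : Fin n → ℤ) (b : D.B) :
    ∃ s : Finset (Fin n → ℤ), γ ∉ s ∧ b = D.component γ b + ∑ α ∈ s, D.component α b := by
  classical
  obtain ⟨s, hs⟩ := D.eq_sum_mono b.1
  refine ⟨s.erase γ, Finset.notMem_erase γ s, Subtype.ext ?_⟩
  have hsum : ((∑ α ∈ s.erase γ, D.component α b : D.B) : D.SkewLaurent)
      = ∑ α ∈ s.erase γ, D.mono α (D.coeff α b.1) :=
    map_sum D.B.val _ _
  change b.1 = D.mono γ (D.coeff γ b.1) + _
  rw [hsum]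
  by_cases h : γ ∈ s
  · rw [Finset.add_sum_erase s (fun α => D.mono α (D.coeff α b.1)) h]
    exact hs
  · have h0 : D.coeff γ b.1 = 0 := by
      rw [hs, map_sum]
      refine Finset.sum_eq_zero fun α hα => ?_
      rw [SkewLaurentDatum.coeff_mono, if_neg]
      rintro rfl
      exact h hα
    rw [h0, SkewLaurentDatum.mono_zero, zero_add, Finset.erase_eq_of_notMem h]
    exact hs

/-- The relation `σ^α(s) · r t^α = r t^α · s` in `B`. -/
theorem base_sig_mul_homog (α : Fin n → ℤ) (r : D.I α) (s : R) :
    D.base (D.sig α s) * D.homog α r = D.homog α r * D.base s := by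
  refine Subtype.ext ?_
  change D.mono 0 (D.sig α s) * D.mono α r = D.mono α r * D.mono 0 s
  rw [SkewLaurentDatum.mono_mul_mono, SkewLaurentDatum.mono_mul_mono,
    SkewLaurentDatum.cocycle_zero_left, SkewLaurentDatum.cocycle_zero_right,
    SkewLaurentDatum.sig_zero, add_zero, zero_add]
  simp [mul_comm]

theorem exists_sig_eq_of_mem_act {α : Fin n → ℤ} {m : MaximalSpectrum R} {s : R}
    (hs : s ∈ (D.act α m).asIdeal) : ∃ r ∈ m.asIdeal, D.sig α r = s := by
  change s ∈ D.sig α • m.asIdeal at hs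
  refine ⟨(D.sig α)⁻¹ s, ?_, ?_⟩
  · exact Ideal.mem_pointwise_smul_iff_inv_smul_mem.1 hs
  · exact smul_inv_smul (D.sig α) s

theorem act_injective {m : MaximalSpectrum R} (hm : ∀ α, D.act α m = m → α = 0) :
    Function.Injective fun α => D.act α m := by
  intro α β h
  have h' : D.act (-β + α) m = m := by
    rw [act_add, show D.act α m = D.act β m from h, ← act_add, neg_add_cancel, act_zero]
  rw [← sub_eq_zero, ← hm _ h', neg_add_eq_sub]

/-! ### Separation of weights -/

/-- Finitely many maximal ideals different from `m` are separated from `m` by an element of their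
intersection that is `1` modulo `m`. -/
theorem exists_sub_one_mem {ι : Type*} (s : Finset ι) (μ : ι → MaximalSpectrum R)
    (m : MaximalSpectrum R) (hne : ∀ i ∈ s, μ i ≠ m) :
    ∃ r : R, r - 1 ∈ m.asIdeal ∧ ∀ i ∈ s, r ∈ (μ i).asIdeal := by
  have := m.isMaximal
  have h : ∀ i ∈ s, ∃ r ∈ (μ i).asIdeal, r ∉ m.asIdeal := fun i hi =>
    Set.not_subset.1 fun hle => hne i hi <| MaximalSpectrum.ext <|
      (μ i).isMaximal.eq_of_le m.isMaximal.ne_top hle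
  choose! f hf hf' using h
  obtain ⟨a, b, hb, hab⟩ := m.isMaximal.exists_inv (x := ∏ i ∈ s, f i) (by
    rw [m.isMaximal.isPrime.prod_mem_iff]
    rintro ⟨i, hi, hi'⟩
    exact hf' i hi hi')
  refine ⟨a * ∏ i ∈ s, f i, ?_, fun i hi => ?_⟩
  · rw [← hab, sub_add_cancel_left]
    exact neg_mem hb
  · exact Ideal.mul_mem_left _ _ (Ideal.mem_of_dvd _ (Finset.dvd_prod_of_mem f hi) (hf i hi))

section Module

variable {M : Type w} [AddCommGroup M] [Module D.B M]

theorem base_smul_of_sub_one_mem {m : MaximalSpectrum R} {x : M} (hx : x ∈ D.weightSpace M m)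
    {r : R} (hr : r - 1 ∈ m.asIdeal) : D.base r • x = x := by
  have := hx _ hr
  rwa [map_sub, map_one, sub_smul, one_smul, sub_eq_zero] at this

theorem mem_of_base_smul_eq_zero {m : MaximalSpectrum R} {x : M} (hx : x ∈ D.weightSpace M m)
    (hx0 : x ≠ 0) {r : R} (hr : D.base r • x = 0) : r ∈ m.asIdeal := by
  by_contra h
  obtain ⟨a, b, hb, hab⟩ := m.isMaximal.exists_inv h
  refine hx0 ?_
  rw [← D.base_smul_of_sub_one_mem hx (r := a * r) (by
    rw [← hab, sub_add_cancel_left]; exact neg_mem hb), map_mul, mul_smul, hr, smul_zero]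

/-- `r t^α` maps `M_m` into the weight space of `σ^α(m)`. -/
theorem homog_smul_mem (α : Fin n → ℤ) (r : D.I α) {m : MaximalSpectrum R} {x : M}
    (hx : x ∈ D.weightSpace M m) : D.homog α r • x ∈ D.weightSpace M (D.act α m) := by
  intro s hs
  obtain ⟨s, hs', rfl⟩ := D.exists_sig_eq_of_mem_act hs
  rw [← mul_smul, base_sig_mul_homog, mul_smul, hx s hs', smul_zero]

theorem eq_zero_of_eq_sum {ι : Type*} (s : Finset ι) (μ : ι → MaximalSpectrum R) (y : ι → M)
    {m : MaximalSpectrum R} {x : M} (hx : x ∈ D.weightSpace M m)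
    (hy : ∀ i ∈ s, y i ∈ D.weightSpace M (μ i)) (hne : ∀ i ∈ s, μ i ≠ m)
    (h : x = ∑ i ∈ s, y i) : x = 0 := by
  obtain ⟨r, hr, hr'⟩ := exists_sub_one_mem s μ m hne
  rw [← D.base_smul_of_sub_one_mem hx hr, h, Finset.smul_sum]
  exact Finset.sum_eq_zero fun i hi => hy i hi r (hr' i hi)

/-- A module spanned by its weight spaces is a weight module: the sum of the weight spaces is
automatically direct. -/
theorem isWeightModule_of_iSup_eq_top (h : ⨆ m, D.weightSpace M m = ⊤) :
    D.IsWeightModule M := by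
  classical
  refine ⟨(injective_iff_map_eq_zero _).2 fun f hf => ?_, ?_⟩
  · rw [DirectSum.coeAddMonoidHom_eq_dfinsuppSum, DFinsupp.sum] at hf
    ext m
    by_cases hm : m ∈ f.support
    · rw [← Finset.add_sum_erase _ _ hm] at hf
      refine D.eq_zero_of_eq_sum (f.support.erase m) id (fun i => -(f i : M)) (f m).2
        (fun i _ => neg_mem (f i).2) (fun i hi => Finset.ne_of_mem_erase hi) ?_
      rw [Finset.sum_neg_distrib]
      exact eq_neg_of_add_eq_zero_left hf
    · simp [DFinsupp.notMem_support_iff.1 hm]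
  · rw [← AddMonoidHom.range_eq_top, eq_top_iff, ← h, iSup_le_iff]
    intro m x hx
    exact ⟨DirectSum.of (fun m => D.weightSpace M m) m ⟨x, hx⟩,
      DirectSum.coeAddMonoidHom_of _ _ _⟩

theorem exists_ne_zero_of_mem_supp {m : MaximalSpectrum R} (h : m ∈ D.supp M) :
    ∃ x ∈ D.weightSpace M m, x ≠ 0 := by
  obtain ⟨x, hx⟩ := AddSubgroup.ne_bot_iff_exists_ne_zero.1 h
  exact ⟨x.1, x.2, fun h => hx (Subtype.ext h)⟩

theorem supp_nonempty [Nontrivial M] (h : D.IsWeightModule M) : (D.supp M).Nonempty := by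
  obtain ⟨x, hx⟩ := exists_ne (0 : M)
  by_contra hs
  rw [Set.not_nonempty_iff_eq_empty, Set.eq_empty_iff_forall_notMem] at hs
  obtain ⟨f, rfl⟩ := h.2 x
  refine hx ?_
  have : f = 0 := by
    ext m
    exact (AddSubgroup.mem_bot.1 (not_not.1 (hs m) ▸ (f m).2))
  rw [this, map_zero]

/-- If the stabilizer of `m` is trivial, the component of weight `σ^γ(m)` of `b x`, for `x` of
weight `m`, comes from the component of degree `γ` of `b` alone; here for `b x` of weight
`σ^γ(m)`. -/
theorem smul_eq_component_smul {m : MaximalSpectrum R} (hm : ∀ α, D.act α m = m → α = 0) {x : M}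
    (hx : x ∈ D.weightSpace M m) {γ : Fin n → ℤ} {b : D.B}
    (hb : b • x ∈ D.weightSpace M (D.act γ m)) : b • x = D.component γ b • x := by
  obtain ⟨s, hγ, hs⟩ := D.exists_eq_component_add_sum γ b
  rw [← sub_eq_zero]
  refine D.eq_zero_of_eq_sum s (fun α => D.act α m) (fun α => D.component α b • x)
    (sub_mem hb (D.homog_smul_mem γ _ hx)) (fun α _ => D.homog_smul_mem α _ hx) ?_ ?_
  · intro α hα h
    exact hγ (D.act_injective hm h ▸ hα)
  · rw [sub_eq_iff_eq_add', ← Finset.sum_smul, ← add_smul, ← hs]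

theorem coeff_zero_mem_of_smul_eq_zero {m : MaximalSpectrum R}
    (hm : ∀ α, D.act α m = m → α = 0) {x : M} (hx : x ∈ D.weightSpace M m) (hx0 : x ≠ 0)
    {b : D.B} (hb : b • x = 0) : D.coeff 0 b.1 ∈ m.asIdeal := by
  refine D.mem_of_base_smul_eq_zero hx hx0 ?_
  rw [← component_zero, ← D.smul_eq_component_smul hm hx (γ := 0) (by rw [hb]; exact zero_mem _),
    hb]

end Module

/-! ### The maximal left ideal of a point -/

/-- The left ideal `L_m = {b ∈ B | (b' b)_0 ∈ m for all b' ∈ B}`. -/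
def annIdeal (m : MaximalSpectrum R) : Ideal D.B where
  carrier := {b | ∀ b' : D.B, D.coeff 0 (b' * b : D.B).1 ∈ m.asIdeal}
  zero_mem' b' := by
    rw [mul_zero]
    exact (map_zero (D.coeff 0)).symm ▸ zero_mem _
  add_mem' {a b} ha hb b' := by
    rw [mul_add]
    exact (map_add (D.coeff 0) (b' * a : D.B).1 (b' * b : D.B).1).symm ▸ add_mem (ha b') (hb b')
  smul_mem' c b hb b' := by
    rw [smul_eq_mul, ← mul_assoc]
    exact hb (b' * c)

theorem mem_annIdeal {m : MaximalSpectrum R} {b : D.B} :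
    b ∈ D.annIdeal m ↔ ∀ b' : D.B, D.coeff 0 (b' * b : D.B).1 ∈ m.asIdeal := Iff.rfl

theorem homog_mem_annIdeal {m : MaximalSpectrum R} {α : Fin n → ℤ} {r : D.I α} :
    D.homog α r ∈ D.annIdeal m ↔ ∀ s ∈ D.I (-α), s * D.sig (-α) r ∈ m.asIdeal := by
  have key : ∀ b' : D.B, D.coeff 0 (b' * D.homog α r : D.B).1 ∈ m.asIdeal
      ↔ D.coeff (-α) b'.1 * D.sig (-α) r ∈ m.asIdeal := by
    intro b'
    have h := D.coeff_mul_mono b'.1 α (-α) r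
    rw [neg_add_cancel] at h
    change D.coeff 0 (b'.1 * D.mono α r) ∈ _ ↔ _
    rw [h]
    exact ((m.asIdeal.restrictScalars k).smul_mem_iff (D.cocycle (-α) α).ne_zero)
  rw [mem_annIdeal]
  constructor
  · intro h s hs
    simpa [homog, SkewLaurentDatum.coeff_mono] using (key (D.homog (-α) ⟨s, hs⟩)).1 (h _)
  · exact fun h b' => (key b').2 (h _ (b'.2 _))

theorem base_mem_annIdeal {m : MaximalSpectrum R} {r : R} (hr : r ∈ m.asIdeal) :
    D.base r ∈ D.annIdeal m := by
  refine (D.homog_mem_annIdeal (α := 0) (r := ⟨r, D.mem_I_zero r⟩)).2 fun s _ => ?_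
  rw [neg_zero, SkewLaurentDatum.sig_zero]
  exact Ideal.mul_mem_left _ _ hr

theorem one_notMem_annIdeal (m : MaximalSpectrum R) : (1 : D.B) ∉ D.annIdeal m := by
  intro h
  have h1 := h 1
  rw [mul_one] at h1
  change D.coeff 0 (D.mono 0 1) ∈ _ at h1
  rw [SkewLaurentDatum.coeff_mono, if_pos rfl] at h1
  exact m.isMaximal.ne_top ((Ideal.eq_top_iff_one _).2 h1)

theorem annIdeal_isMaximal {m : MaximalSpectrum R} (hm : ∀ α, D.act α m = m → α = 0) :
    (D.annIdeal m).IsMaximal := by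
  refine Ideal.isMaximal_iff.2 ⟨D.one_notMem_annIdeal m, fun K b hK hb hbK => ?_⟩
  rw [mem_annIdeal, not_forall] at hb
  obtain ⟨b', hb'⟩ := hb
  obtain ⟨s, h0, hs⟩ := D.exists_eq_component_add_sum 0 (b' * b)
  obtain ⟨a, c, hc, hac⟩ := m.isMaximal.exists_inv hb'
  -- `r` annihilates the components of `b' b` of nonzero degree modulo `L_m`.
  obtain ⟨r, hr, hr'⟩ := exists_sub_one_mem s (fun α => D.act α m) m fun α hα h =>
    h0 (hm α h ▸ hα)
  have hsum : D.base r * ∑ α ∈ s, D.component α (b' * b) ∈ D.annIdeal m := by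
    rw [Finset.mul_sum]
    refine sum_mem fun α hα => ?_
    obtain ⟨t, ht, hrt⟩ := D.exists_sig_eq_of_mem_act (hr' α hα)
    rw [component, ← hrt, base_sig_mul_homog]
    exact Ideal.mul_mem_left _ _ (D.base_mem_annIdeal ht)
  set x := D.coeff 0 (b' * b : D.B).1
  -- Modulo `L_m`, the element `a r b' b` is `a r x`, and `a r x ≡ 1` modulo `m`.
  have hone : (1 : D.B) = D.base a * (D.base r * (b' * b))
      - (D.base a * (D.base r * ∑ α ∈ s, D.component α (b' * b))
        + D.base (a * ((r - 1) * x) - c)) := by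
    have h1 : D.base a * (D.base r * (b' * b)) = D.base (a * (r * x))
        + D.base a * (D.base r * ∑ α ∈ s, D.component α (b' * b)) := by
      conv_lhs => rw [hs]
      rw [component_zero, mul_add, mul_add, map_mul, map_mul]
    have h2 : D.base (a * (r * x)) - D.base (a * ((r - 1) * x) - c) = 1 := by
      rw [← map_sub, ← map_one D.base]
      exact congrArg D.base (by linear_combination hac)
    rw [h1, ← h2]
    abel
  rw [hone]
  refine sub_mem (Ideal.mul_mem_left _ _ (Ideal.mul_mem_left _ _ (Ideal.mul_mem_left _ _ hbK)))
    (hK (add_mem (Ideal.mul_mem_left _ _ hsum) (D.base_mem_annIdeal (sub_mem ?_ hc))))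
  exact Ideal.mul_mem_left _ _ (Ideal.mul_mem_right _ _ hr)

section Module

variable {M : Type w} [AddCommGroup M] [Module D.B M]

/-- The annihilator of a weight vector in a simple module depends only on its weight. -/
theorem ker_toSpanSingleton_eq [IsSimpleModule D.B M] {m : MaximalSpectrum R}
    (hm : ∀ α, D.act α m = m → α = 0) {x : M} (hx : x ∈ D.weightSpace M m) (hx0 : x ≠ 0) :
    LinearMap.ker (LinearMap.toSpanSingleton D.B M x) = D.annIdeal m := by
  have hcoatom : IsCoatom (LinearMap.ker (LinearMap.toSpanSingleton D.B M x)) := by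
    rw [← isSimpleModule_iff_isCoatom]
    exact IsSimpleModule.congr (LinearMap.quotKerEquivOfSurjective _
      (IsSimpleModule.toSpanSingleton_surjective D.B hx0))
  refine ((hcoatom.le_iff_eq ?_).1 fun b hb => D.mem_annIdeal.2 fun b' => ?_).symm
  · exact (Ideal.ne_top_iff_one _).2 (D.one_notMem_annIdeal m)
  · refine D.coeff_zero_mem_of_smul_eq_zero hm hx hx0 ?_
    rw [mul_smul, show b • x = 0 from hb, smul_zero]

theorem smul_eq_zero_iff_mem_annIdeal [IsSimpleModule D.B M] {m : MaximalSpectrum R}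
    (hm : ∀ α, D.act α m = m → α = 0) {x : M} (hx : x ∈ D.weightSpace M m) (hx0 : x ≠ 0)
    {b : D.B} : b • x = 0 ↔ b ∈ D.annIdeal m := by
  rw [← D.ker_toSpanSingleton_eq hm hx hx0, LinearMap.mem_ker, LinearMap.toSpanSingleton_apply]

theorem nonempty_linearEquiv_quotient [IsSimpleModule D.B M] {m : MaximalSpectrum R}
    (hm : ∀ α, D.act α m = m → α = 0) (h : m ∈ D.supp M) :
    Nonempty (M ≃ₗ[D.B] D.B ⧸ D.annIdeal m) := by
  obtain ⟨x, hx, hx0⟩ := D.exists_ne_zero_of_mem_supp h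
  exact ⟨((Submodule.quotEquivOfEq _ _ (D.ker_toSpanSingleton_eq hm hx hx0)).symm.trans
    (LinearMap.quotKerEquivOfSurjective _
      (IsSimpleModule.toSpanSingleton_surjective D.B hx0))).symm⟩

/-- For a vector `x` of weight `m` in a simple module, `σ^α(m)` is a weight if and only if some
`r t^α` does not annihilate `x`, that is, some product of elements of degrees `-α` and `α` does
not. -/
theorem act_mem_supp_iff [IsSimpleModule D.B M] {m : MaximalSpectrum R}
    (hm : ∀ α, D.act α m = m → α = 0) (h : m ∈ D.supp M) (α : Fin n → ℤ) :
    D.act α m ∈ D.supp M ↔ ¬ D.I (-α) * (D.sig (-α) • D.I α) ≤ m.asIdeal := by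
  obtain ⟨x, hx, hx0⟩ := D.exists_ne_zero_of_mem_supp h
  have h1 : D.act α m ∈ D.supp M ↔ ∃ r : D.I α, D.homog α r ∉ D.annIdeal m := by
    simp only [← D.smul_eq_zero_iff_mem_annIdeal hm hx hx0]
    constructor
    · intro hα
      obtain ⟨y, hy, hy0⟩ := D.exists_ne_zero_of_mem_supp hα
      obtain ⟨b, rfl⟩ := IsSimpleModule.toSpanSingleton_surjective D.B hx0 y
      exact ⟨⟨D.coeff α b.1, b.2 α⟩, fun h0 =>
        hy0 ((D.smul_eq_component_smul hm hx hy).trans h0)⟩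
    · rintro ⟨r, hr⟩ hbot
      exact hr (AddSubgroup.mem_bot.1 (hbot ▸ D.homog_smul_mem α r hx))
  rw [h1, ← not_forall, not_iff_not]
  simp only [homog_mem_annIdeal]
  constructor
  · intro h
    refine Ideal.mul_le.2 fun s hs t ht => ?_
    obtain ⟨r, hr, rfl⟩ : ∃ r ∈ D.I α, D.sig (-α) r = t :=
      ⟨(D.sig (-α))⁻¹ t, Ideal.mem_pointwise_smul_iff_inv_smul_mem.1 ht,
        smul_inv_smul (D.sig (-α)) t⟩
    exact h ⟨r, hr⟩ s hs
  · intro h r s hs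
    exact h (Ideal.mul_mem_mul hs (Ideal.smul_mem_pointwise_smul (D.sig (-α)) _ _ r.2))

/-- A module generated by a vector of weight `m` is a weight module supported in the orbit of
`m`. -/
theorem isWeightModule_and_supp_subset {m : MaximalSpectrum R} {x : M}
    (hx : x ∈ D.weightSpace M m) (hgen : ∀ y : M, ∃ b : D.B, b • x = y) :
    D.IsWeightModule M ∧ D.supp M ⊆ Set.range fun α => D.act α m := by
  have hdec : ∀ y : M, ∃ (s : Finset (Fin n → ℤ)) (f : (Fin n → ℤ) → M),
      (∀ α ∈ s, f α ∈ D.weightSpace M (D.act α m)) ∧ y = ∑ α ∈ s, f α := by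
    intro y
    obtain ⟨b, rfl⟩ := hgen y
    obtain ⟨s, hs, hb⟩ := D.exists_eq_component_add_sum 0 b
    refine ⟨Finset.cons 0 s hs, fun α => D.component α b • x,
      fun α _ => D.homog_smul_mem α _ hx, ?_⟩
    rw [Finset.sum_cons, ← Finset.sum_smul, ← add_smul, ← hb]
  constructor
  · refine D.isWeightModule_of_iSup_eq_top (eq_top_iff.2 fun y _ => ?_)
    obtain ⟨s, f, hf, rfl⟩ := hdec y
    exact sum_mem fun α hα => AddSubgroup.mem_iSup_of_mem _ (hf α hα)
  · intro m' hm'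
    by_contra hne
    refine hm' (eq_bot_iff.2 fun y hy => ?_)
    obtain ⟨s, f, hf, hsum⟩ := hdec y
    exact D.eq_zero_of_eq_sum s (fun α => D.act α m) f hy hf
      (fun α _ h => hne ⟨α, h⟩) hsum

theorem exists_simpleWeightModule_of_linearEquiv {O : Set (MaximalSpectrum R)}
    {m : MaximalSpectrum R} (hO : O = Set.range fun α => D.act α m)
    (hm : ∀ α, D.act α m = m → α = 0) (e : M ≃ₗ[D.B] D.B ⧸ D.annIdeal m) :
    ∃ X : SimpleWeightModule.{u, v, w} D O, m ∈ D.supp X.M := by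
  have : IsSimpleModule D.B (D.B ⧸ D.annIdeal m) :=
    isSimpleModule_iff_isCoatom.2 (D.annIdeal_isMaximal hm).out
  have hM : IsSimpleModule D.B M := IsSimpleModule.congr e
  obtain ⟨x, hex⟩ := e.surjective (Submodule.Quotient.mk 1)
  have hx0 : x ≠ 0 := by
    rintro rfl
    rw [map_zero, eq_comm, Submodule.Quotient.mk_eq_zero] at hex
    exact D.one_notMem_annIdeal m hex
  have hx : x ∈ D.weightSpace M m := by
    intro r hr
    refine e.injective ?_
    rw [map_smul, hex, map_zero, ← Submodule.Quotient.mk_smul, smul_eq_mul, mul_one,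
      Submodule.Quotient.mk_eq_zero]
    exact D.base_mem_annIdeal hr
  obtain ⟨h1, h2⟩ := D.isWeightModule_and_supp_subset hx
    (IsSimpleModule.toSpanSingleton_surjective D.B hx0)
  exact ⟨⟨M, hM, h1, hO ▸ h2⟩, fun hbot => hx0 (AddSubgroup.mem_bot.1 (hbot ▸ hx))⟩

end Module

/-- Every point of a torsion-free orbit is in the support of a simple weight module, realized in
any universe that contains the one of `R`. -/
theorem exists_simpleWeightModule {O : Set (MaximalSpectrum R)} {m : MaximalSpectrum R}
    (hO : O = Set.range fun α => D.act α m) (hm : ∀ α, D.act α m = m → α = 0) :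
    ∃ X : SimpleWeightModule.{u, v, max v w} D O, m ∈ D.supp X.M :=
  D.exists_simpleWeightModule_of_linearEquiv hO hm
    (ULift.moduleEquiv : ULift.{w} (D.B ⧸ D.annIdeal m) ≃ₗ[D.B] D.B ⧸ D.annIdeal m)

end BRDatum

/-! ### Cells of the integers cut out by a set of breaks -/

/-- `a` lies in the interval of `ℤ` whose upper end is `x` and whose (excluded) lower end is the
largest element of `T` below `x`, or `-∞` if there is none. -/
def InCell (T : Set ℤ) (a : ℤ) (x : WithTop ℤ) : Prop :=
  (∀ t ∈ T, (t : WithTop ℤ) < x → t < a) ∧ (a : WithTop ℤ) ≤ x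

/-- `x` is the upper end of a cell: an element of `T`, or `⊤` if `T` is bounded above. -/
def IsCellEnd (T : Set ℤ) (x : WithTop ℤ) : Prop :=
  (x = ⊤ ∧ BddAbove T) ∨ ∃ t ∈ T, x = (t : WithTop ℤ)

theorem exists_inCell (T : Set ℤ) (a : ℤ) : ∃ x, IsCellEnd T x ∧ InCell T a x := by
  by_cases h : ∃ t, t ∈ T ∧ a ≤ t
  · obtain ⟨t, ⟨ht, hat⟩, hmin⟩ := Int.exists_least_of_bdd ⟨a, fun z hz => hz.2⟩ h
    refine ⟨t, Or.inr ⟨t, ht, rfl⟩, fun s hs hst => ?_, WithTop.coe_le_coe.2 hat⟩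
    by_contra has
    exact (WithTop.coe_lt_coe.1 hst).not_ge (hmin s ⟨hs, not_lt.1 has⟩)
  · push Not at h
    exact ⟨⊤, Or.inl ⟨rfl, a, fun t ht => (h t ht).le⟩, fun t ht _ => h t ht, le_top⟩

theorem IsCellEnd.exists_inCell {T : Set ℤ} {x : WithTop ℤ} (hx : IsCellEnd T x) :
    ∃ a, InCell T a x := by
  obtain ⟨rfl, b, hb⟩ | ⟨t, ht, rfl⟩ := hx
  · exact ⟨b + 1, fun t ht _ => Int.lt_add_one_of_le (hb ht), le_top⟩
  · exact ⟨t, fun s _ hst => WithTop.coe_lt_coe.1 hst, le_rfl⟩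

theorem InCell.end_unique {T : Set ℤ} {a : ℤ} {x y : WithTop ℤ} (hx : IsCellEnd T x)
    (hy : IsCellEnd T y) (hax : InCell T a x) (hay : InCell T a y) : x = y := by
  have key : ∀ {x y : WithTop ℤ}, IsCellEnd T x → InCell T a x → InCell T a y → ¬ x < y := by
    intro x y hx hax hay hxy
    obtain ⟨rfl, -⟩ | ⟨t, ht, rfl⟩ := hx
    · exact not_top_lt hxy
    · exact (hay.1 t ht hxy).not_ge (WithTop.coe_le_coe.1 hax.2)
  exact le_antisymm (not_lt.1 (key hy hay hax)) (not_lt.1 (key hx hax hay))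

theorem InCell.inCell_iff {T : Set ℤ} {a b : ℤ} {x : WithTop ℤ} (hx : IsCellEnd T x)
    (ha : InCell T a x) :
    InCell T b x ↔ ∀ t ∈ T, ¬ (a ≤ t ∧ t < b) ∧ ¬ (b ≤ t ∧ t < a) := by
  constructor
  · have key : ∀ {a b t : ℤ}, t ∈ T → InCell T a x → InCell T b x → ¬ (a ≤ t ∧ t < b) :=
      fun {a b t} ht ha hb h =>
        (ha.1 t ht ((WithTop.coe_lt_coe.2 h.2).trans_le hb.2)).not_ge h.1
    exact fun hb t ht => ⟨key ht ha hb, key ht hb ha⟩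
  · intro h
    refine ⟨fun t ht htx => ?_, ?_⟩
    · have h1 := ha.1 t ht htx
      have h2 := (h t ht).2
      lia
    · obtain ⟨rfl, -⟩ | ⟨t, ht, rfl⟩ := hx
      · exact le_top
      · have h1 := WithTop.coe_le_coe.1 ha.2
        have h2 := (h t ht).1
        exact WithTop.coe_le_coe.2 (by lia)

namespace BRDatum

variable {k : Type u} [Field k] {R : Type v} [CommRing R] [Algebra k R] {n : ℕ}
  (D : BRDatum k R n)

/-! ### Breaks between two points of an orbit -/

/-- The positions of the `i`-breaks on the line through `m` in direction `i`. -/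
def breakSet (i : Fin n) (m : MaximalSpectrum R) : Set ℤ :=
  {a | D.IsBreak i (D.act (Pi.single i a) m)}

theorem sig_smul_H_mul_J {i : Fin n} {β : Fin n → ℤ} (hβ : β i = 0) :
    D.sig β • (D.H i * D.J i) = D.H i * D.J i := by
  have hJ := D.sig_smul_brIdeal β i 1
  have hH := D.sig_smul_brIdeal (β + Pi.single i 1) i (-1)
  have h1 : Finset.Ico (-1 : ℤ) 0 = {-1} := rfl
  have h2 : Finset.Ico (0 : ℤ) 1 = {0} := rfl
  rw [hβ] at hJ
  rw [Pi.add_apply, hβ, Pi.single_eq_same, SkewLaurentDatum.sig_add, mul_smul,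
    SkewLaurentDatum.sig_single] at hH
  simp only [brIdeal, h2, Finset.prod_singleton, zpow_zero, one_smul, zero_lt_one.not_gt,
    Finset.Ico_eq_empty, not_false_eq_true, Finset.prod_empty, mul_one] at hJ
  simp only [brIdeal, h1, Finset.prod_singleton, zero_add, zpow_one,
    Finset.Ico_eq_empty, Finset.prod_empty, one_mul, zpow_neg, smul_inv_smul,
    show ¬ (0 : ℤ) < -1 by decide, not_false_eq_true] at hH
  rw [smul_mul', hH, hJ]

theorem isBreak_act_iff {i : Fin n} (α : Fin n → ℤ) (m : MaximalSpectrum R) :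
    D.IsBreak i (D.act α m) ↔ α i ∈ D.breakSet i m := by
  set β : Fin n → ℤ := α - Pi.single i (α i) with hβ
  have hβi : β i = 0 := by simp [hβ]
  have hα : α = β + Pi.single i (α i) := by simp [hβ]
  conv_lhs => rw [hα, act_add]
  change D.H i * D.J i ≤ D.σ i • D.sig β • (D.act (Pi.single i (α i)) m).asIdeal ↔
    D.H i * D.J i ≤ D.σ i • (D.act (Pi.single i (α i)) m).asIdeal
  have hσ : D.σ i = D.sig (Pi.single i 1) := by rw [SkewLaurentDatum.sig_single, zpow_one]
  rw [hσ, ← mul_smul, ← SkewLaurentDatum.sig_add, add_comm, SkewLaurentDatum.sig_add, mul_smul,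
    Ideal.subset_pointwise_smul_iff]
  conv_lhs => rw [← D.sig_smul_H_mul_J hβi, inv_smul_smul]

theorem brIdeal_neg_mul_smul_brIdeal (σ : R ≃ₐ[k] R) (H J : Ideal R) (a : ℤ) :
    brIdeal σ H J (-a) * (σ ^ (-a) • brIdeal σ H J a)
      = (∏ j ∈ Finset.Ico 0 (-a), σ ^ j • (H * J)) * ∏ j ∈ Finset.Ico (-a) 0, σ ^ j • (H * J) := by
  have key : ∀ (L : Ideal R) (c d : ℤ), σ ^ (-a) • ∏ j ∈ Finset.Ico c d, (σ ^ j) • L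
      = ∏ j ∈ Finset.Ico (-a + c) (-a + d), (σ ^ j) • L := by
    intro L c d
    rw [smul_prod, ← Finset.map_add_left_Ico, Finset.prod_map]
    simp [smul_smul, zpow_add]
  unfold brIdeal
  rw [smul_mul', key, key, add_zero, neg_add_cancel, mul_mul_mul_comm]
  simp only [smul_mul', Finset.prod_mul_distrib]
  ring

/-- `I^{(-α)} σ^{-α}(I^{(α)})`, the ideal of all coefficients of products of elements of degree
`-α` and `α`, is contained in `m` if and only if some break separates `m` from `σ^α(m)`. -/
theorem I_neg_mul_sig_smul_I_le_iff (α : Fin n → ℤ) (m : MaximalSpectrum R) :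
    D.I (-α) * (D.sig (-α) • D.I α) ≤ m.asIdeal
      ↔ ∃ i, ∃ t ∈ D.breakSet i m, (0 ≤ t ∧ t < α i) ∨ (α i ≤ t ∧ t < 0) := by
  have hm := m.isMaximal.isPrime
  have hprod : D.I (-α) * (D.sig (-α) • D.I α)
      = ∏ i, ((∏ j ∈ Finset.Ico 0 (-α i), D.σ i ^ j • (D.H i * D.J i))
        * ∏ j ∈ Finset.Ico (-α i) 0, D.σ i ^ j • (D.H i * D.J i)) := by
    unfold I
    rw [smul_prod, ← Finset.prod_mul_distrib]
    refine Finset.prod_congr rfl fun i _ => ?_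
    rw [sig_smul_brIdeal]
    exact brIdeal_neg_mul_smul_brIdeal _ _ _ _
  have hbreak : ∀ (i : Fin n) (j : ℤ),
      D.σ i ^ j • (D.H i * D.J i) ≤ m.asIdeal ↔ -j - 1 ∈ D.breakSet i m := by
    intro i j
    rw [Ideal.pointwise_smul_subset_iff]
    change _ ↔ D.H i * D.J i ≤ D.σ i • D.sig (Pi.single i (-j - 1)) • m.asIdeal
    rw [SkewLaurentDatum.sig_single, ← mul_smul, mul_self_zpow, sub_add_cancel, zpow_neg]
  rw [hprod, hm.prod_le]
  simp only [Finset.mem_univ, true_and, hm.mul_le, hm.prod_le, Finset.mem_Ico, hbreak]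
  refine exists_congr fun i => ?_
  constructor
  · rintro (⟨j, hj, h⟩ | ⟨j, hj, h⟩)
    · exact ⟨_, h, Or.inr (by lia)⟩
    · exact ⟨_, h, Or.inl (by lia)⟩
  · rintro ⟨t, h, ht | ht⟩
    · exact Or.inr ⟨-t - 1, by lia, by simpa using h⟩
    · exact Or.inl ⟨-t - 1, by lia, by simpa using h⟩

/-! ### Hyperplanes of breaks and their levels -/

theorem prec_iff {i : Fin n} {m m' : MaximalSpectrum R} :
    D.Prec i m m' ↔ ∃ l : ℤ, 0 < l ∧ m' = D.act (Pi.single i l) m := by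
  constructor
  · intro h
    induction h with
    | single h => exact ⟨1, one_pos, h⟩
    | tail _ h ih =>
      obtain ⟨l, hl, rfl⟩ := ih
      refine ⟨1 + l, by lia, ?_⟩
      rw [h, ← act_add, Pi.single_add]
  · rintro ⟨l, hl, rfl⟩
    induction l, hl using Int.leInduction with
    | base => exact Relation.TransGen.single rfl
    | succ l hl ih =>
      refine ih.tail ?_
      rw [← act_add, ← Pi.single_add, add_comm]

variable {D} {O : Set (MaximalSpectrum R)} {i : Fin n} {m : MaximalSpectrum R}

theorem prec_act_iff (hm : ∀ α, D.act α m = m → α = 0) {α β : Fin n → ℤ} :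
    D.Prec i (D.act α m) (D.act β m) ↔ ∃ l : ℤ, 0 < l ∧ β = Pi.single i l + α := by
  simp only [prec_iff, ← act_add, (D.act_injective hm).eq_iff]

theorem hyper_eq_iff (hm : ∀ α, D.act α m = m → α = 0) {α β : Fin n → ℤ}
    (hα : D.act α m ∈ D.breaks O i) (hβ : D.act β m ∈ D.breaks O i) :
    D.hyper O i ⟨_, hα⟩ = D.hyper O i ⟨_, hβ⟩ ↔ α i = β i := by
  refine Quotient.eq.trans ⟨?_, fun h => ⟨β - α, by simp [h], ?_⟩⟩
  · rintro ⟨γ, hγ, h⟩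
    rw [← act_add] at h
    rw [← D.act_injective hm h, Pi.add_apply, hγ, zero_add]
  · rw [← act_add, sub_add_cancel]

theorem act_mem_orbit (hO : O = Set.range fun α => D.act α m) (α : Fin n → ℤ) :
    D.act α m ∈ O := hO ▸ ⟨α, rfl⟩

theorem act_mem_breaks_iff (hO : O = Set.range fun α => D.act α m) {α : Fin n → ℤ} :
    D.act α m ∈ D.breaks O i ↔ α i ∈ D.breakSet i m :=
  (and_iff_right (act_mem_orbit hO α)).trans (D.isBreak_act_iff α m)

theorem exists_eq_hyper (hO : O = Set.range fun α => D.act α m) (h : D.Hyper O i) :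
    ∃ (α : Fin n → ℤ) (hα : D.act α m ∈ D.breaks O i), h = D.hyper O i ⟨_, hα⟩ := by
  obtain ⟨⟨b, hb⟩, rfl⟩ := Quotient.exists_rep h
  obtain ⟨α, rfl⟩ : b ∈ Set.range fun α => D.act α m := hO ▸ hb.1
  exact ⟨α, hb, rfl⟩

/-- The common `i`-th coordinate of the breaks of a hyperplane, the orbit being identified with
`ℤ^n` by the choice of the origin `m`. -/
noncomputable def level (hO : O = Set.range fun α => D.act α m) (h : D.Hyper O i) : ℤ :=
  (exists_eq_hyper hO h).choose i

theorem level_hyper (hO : O = Set.range fun α => D.act α m) (hm : ∀ α, D.act α m = m → α = 0)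
    {α : Fin n → ℤ} (hα : D.act α m ∈ D.breaks O i) :
    level hO (D.hyper O i ⟨_, hα⟩) = α i := by
  obtain ⟨hβ, h⟩ := (exists_eq_hyper hO (D.hyper O i ⟨_, hα⟩)).choose_spec
  exact ((hyper_eq_iff hm hα hβ).1 h).symm

theorem level_mem (hO : O = Set.range fun α => D.act α m) (hm : ∀ α, D.act α m = m → α = 0)
    (h : D.Hyper O i) : level hO h ∈ D.breakSet i m := by
  obtain ⟨α, hα, rfl⟩ := exists_eq_hyper hO h
  rw [level_hyper hO hm]
  exact (act_mem_breaks_iff hO).1 hα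

theorem exists_level_eq (hO : O = Set.range fun α => D.act α m)
    (hm : ∀ α, D.act α m = m → α = 0) {t : ℤ} (ht : t ∈ D.breakSet i m) :
    ∃ h : D.Hyper O i, level hO h = t := by
  have hb : D.act (Pi.single i t) m ∈ D.breaks O i := (act_mem_breaks_iff hO).2 (by simpa using ht)
  exact ⟨D.hyper O i ⟨_, hb⟩, by rw [level_hyper hO hm, Pi.single_eq_same]⟩

theorem level_injective (hO : O = Set.range fun α => D.act α m)
    (hm : ∀ α, D.act α m = m → α = 0) :
    Function.Injective (level hO : D.Hyper O i → ℤ) := by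
  intro h h' e
  obtain ⟨α, hα, rfl⟩ := exists_eq_hyper hO h
  obtain ⟨β, hβ, rfl⟩ := exists_eq_hyper hO h'
  rw [level_hyper hO hm, level_hyper hO hm] at e
  exact (hyper_eq_iff hm hα hβ).2 e

/-- A hyperplane of `i`-breaks meets every line in direction `i`, here the one through
`σ^α(m)`. -/
theorem exists_hyper_eq (hO : O = Set.range fun α => D.act α m)
    (hm : ∀ α, D.act α m = m → α = 0) (h : D.Hyper O i) (α : Fin n → ℤ) :
    ∃ hb : D.act (Pi.single i (level hO h - α i) + α) m ∈ D.breaks O i,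
      h = D.hyper O i ⟨_, hb⟩ := by
  have hi : (Pi.single i (level hO h - α i) + α : Fin n → ℤ) i = level hO h := by simp
  have hb : D.act (Pi.single i (level hO h - α i) + α) m ∈ D.breaks O i := by
    rw [act_mem_breaks_iff hO, hi]
    exact level_mem hO hm h
  exact ⟨hb, level_injective hO hm (hi.symm.trans (level_hyper hO hm hb).symm)⟩

theorem lt_iff_level_lt (hO : O = Set.range fun α => D.act α m)
    (hm : ∀ α, D.act α m = m → α = 0) {h h' : D.Hyper O i} :
    h < h' ↔ level hO h < level hO h' := by
  constructor
  · rintro ⟨⟨b, hb⟩, ⟨c, hc⟩, rfl, rfl, hbc⟩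
    obtain ⟨α, rfl⟩ : b ∈ Set.range fun α => D.act α m := hO ▸ hb.1
    obtain ⟨β, rfl⟩ : c ∈ Set.range fun α => D.act α m := hO ▸ hc.1
    obtain ⟨l, hl, rfl⟩ := (prec_act_iff hm).1 hbc
    rw [level_hyper hO hm, level_hyper hO hm]
    simpa using hl
  · intro hlt
    obtain ⟨α, hα, rfl⟩ := exists_eq_hyper hO h
    obtain ⟨hb, h2⟩ := exists_hyper_eq hO hm h' α
    refine ⟨_, _, rfl, h2.symm, (prec_act_iff hm).2 ⟨_, ?_, rfl⟩⟩
    rw [level_hyper hO hm] at hlt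
    exact sub_pos.2 hlt

/-- The level of an element of `β̄'_i`, where `∞_i` has level `⊤`. -/
noncomputable def level' (hO : O = Set.range fun α => D.act α m) (x : D.Hyper' O i) : WithTop ℤ :=
  x.1.map (level hO)

theorem level'_injective (hO : O = Set.range fun α => D.act α m)
    (hm : ∀ α, D.act α m = m → α = 0) :
    Function.Injective (level' hO : D.Hyper' O i → WithTop ℤ) := fun _ _ h =>
  Subtype.ext (Option.map_injective (level_injective hO hm) h)

theorem lt_iff_level'_lt (hO : O = Set.range fun α => D.act α m)
    (hm : ∀ α, D.act α m = m → α = 0) {x y : D.Hyper' O i} :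
    x < y ↔ level' hO x < level' hO y := by
  change x.1 < y.1 ↔ x.1.map (level hO) < y.1.map (level hO)
  induction x.1 using WithTop.recTopCoe with
  | top => simp
  | coe h =>
    induction y.1 using WithTop.recTopCoe with
    | top => simp
    | coe h' =>
      rw [WithTop.map_coe, WithTop.map_coe, WithTop.coe_lt_coe, WithTop.coe_lt_coe]
      exact lt_iff_level_lt hO hm

theorem exists_level'_eq_coe (hO : O = Set.range fun α => D.act α m)
    (hm : ∀ α, D.act α m = m → α = 0) {t : ℤ} (ht : t ∈ D.breakSet i m) :
    ∃ x : D.Hyper' O i, level' hO x = t := by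
  obtain ⟨h, rfl⟩ := exists_level_eq hO hm ht
  exact ⟨⟨h, fun h' => absurd h' WithTop.coe_ne_top⟩, rfl⟩

/-- The condition for adjoining `∞_i` says that the set of levels of breaks is bounded above. -/
theorem bddAbove_iff (hO : O = Set.range fun α => D.act α m)
    (hm : ∀ α, D.act α m = m → α = 0) :
    BddAbove (D.breakSet i m) ↔
      IsEmpty (D.Hyper O i) ∨ ∃ b : D.Hyper O i, ∀ c, ¬ b < c := by
  constructor
  · rintro ⟨u, hu⟩
    refine (isEmpty_or_nonempty (D.Hyper O i)).imp_right fun ⟨h⟩ => ?_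
    obtain ⟨t, ht, hmax⟩ := Int.exists_greatest_of_bdd (P := (· ∈ D.breakSet i m))
      ⟨u, fun z hz => hu hz⟩ ⟨_, level_mem hO hm h⟩
    obtain ⟨b, rfl⟩ := exists_level_eq hO hm ht
    refine ⟨b, fun c hbc => ?_⟩
    exact ((lt_iff_level_lt hO hm).1 hbc).not_ge (hmax _ (level_mem hO hm c))
  · rintro (h | ⟨b, hb⟩)
    · refine ⟨0, fun t ht => ?_⟩
      obtain ⟨b, -⟩ := exists_level_eq hO hm ht
      exact isEmptyElim b
    · refine ⟨level hO b, fun t ht => ?_⟩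
      obtain ⟨c, rfl⟩ := exists_level_eq hO hm ht
      exact not_lt.1 fun hlt => hb c ((lt_iff_level_lt hO hm).2 hlt)

/-- The levels of the elements of `β̄'_i` are the upper ends of the cells cut out by the breaks. -/
theorem exists_level'_eq_iff (hO : O = Set.range fun α => D.act α m)
    (hm : ∀ α, D.act α m = m → α = 0) {z : WithTop ℤ} :
    (∃ x : D.Hyper' O i, level' hO x = z) ↔ IsCellEnd (D.breakSet i m) z := by
  constructor
  · rintro ⟨⟨x, hx⟩, rfl⟩
    induction x using WithTop.recTopCoe with
    | top => exact Or.inl ⟨rfl, (bddAbove_iff hO hm).2 (hx rfl)⟩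
    | coe h => exact Or.inr ⟨_, level_mem hO hm h, rfl⟩
  · rintro (⟨rfl, h⟩ | ⟨t, ht, rfl⟩)
    · exact ⟨⟨⊤, fun _ => (bddAbove_iff hO hm).1 h⟩, rfl⟩
    · exact exists_level'_eq_coe hO hm ht

/-! ### Boxes in terms of levels -/

theorem pointLE_act_iff (hO : O = Set.range fun α => D.act α m)
    (hm : ∀ α, D.act α m = m → α = 0) {α : Fin n → ℤ} {x : D.Hyper' O i} :
    D.PointLE O i (D.act α m) x ↔ (α i : WithTop ℤ) ≤ level' hO x := by
  obtain ⟨x, hx⟩ := x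
  induction x using WithTop.recTopCoe with
  | top => exact iff_of_true (Or.inl rfl) le_top
  | coe h =>
    change ((h : WithTop (D.Hyper O i)) = ⊤ ∨ _) ↔ (α i : WithTop ℤ) ≤ (level hO h : ℤ)
    rw [or_iff_right WithTop.coe_ne_top, WithTop.coe_le_coe]
    constructor
    · rintro ⟨⟨b, hb⟩, hx, hprec⟩
      obtain rfl := WithTop.coe_injective hx
      obtain ⟨β, rfl⟩ : b ∈ Set.range fun α => D.act α m := hO ▸ hb.1
      rw [level_hyper hO hm]
      obtain heq | hlt := hprec
      · rw [D.act_injective hm heq]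
      · obtain ⟨l, hl, rfl⟩ := (prec_act_iff hm).1 hlt
        simpa using hl.le
    · intro hle
      obtain ⟨hb, h2⟩ := exists_hyper_eq hO hm h α
      refine ⟨_, congrArg _ h2, ?_⟩
      obtain heq | hlt := hle.eq_or_lt
      · left
        simp [heq]
      · exact Or.inr ((prec_act_iff hm).2 ⟨_, sub_pos.2 hlt, rfl⟩)

theorem pointGT_coe_act_iff (hO : O = Set.range fun α => D.act α m)
    (hm : ∀ α, D.act α m = m → α = 0) {α : Fin n → ℤ} {y : D.Hyper' O i} :
    D.PointGT O i (y : WithBot (D.Hyper' O i)) (D.act α m) ↔ level' hO y < (α i : WithTop ℤ) := by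
  have h1 : D.PointGT O i (y : WithBot (D.Hyper' O i)) (D.act α m) ↔
      ∃ b : D.breaks O i, y.1 = (D.hyper O i b : WithTop (D.Hyper O i))
        ∧ D.Prec i b (D.act α m) := by
    constructor
    · rintro (h | ⟨x, b, hx, h⟩)
      · exact absurd h WithBot.coe_ne_bot
      · obtain rfl := WithBot.coe_injective hx
        exact ⟨b, h⟩
    · exact fun ⟨b, h⟩ => Or.inr ⟨y, b, rfl, h⟩
  rw [h1]
  obtain ⟨y, hy⟩ := y
  induction y using WithTop.recTopCoe with
  | top => exact iff_of_false (fun ⟨b, h, _⟩ => WithTop.top_ne_coe h) not_top_lt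
  | coe h =>
    change _ ↔ ((level hO h : ℤ) : WithTop ℤ) < _
    rw [WithTop.coe_lt_coe]
    constructor
    · rintro ⟨⟨b, hb⟩, hx, hlt⟩
      obtain rfl := WithTop.coe_injective hx
      obtain ⟨β, rfl⟩ : b ∈ Set.range fun α => D.act α m := hO ▸ hb.1
      obtain ⟨l, hl, rfl⟩ := (prec_act_iff hm).1 hlt
      rw [level_hyper hO hm]
      simpa using hl
    · intro hlt
      obtain ⟨hb, h2⟩ := exists_hyper_eq hO hm h α
      refine ⟨_, congrArg _ h2, (prec_act_iff hm).2 ⟨α i - level hO h, sub_pos.2 hlt, ?_⟩⟩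
      rw [← add_assoc, ← Pi.single_add]
      simp

/-- `x⁻ ≺_i σ^α(m)` if and only if `α_i` exceeds all levels of breaks below `x`: if there are such
breaks, then there is a highest one. -/
theorem pointGT_pred_act_iff (hO : O = Set.range fun α => D.act α m)
    (hm : ∀ α, D.act α m = m → α = 0) {α : Fin n → ℤ} {x : D.Hyper' O i} :
    D.PointGT O i (D.pred O i x) (D.act α m)
      ↔ ∀ t ∈ D.breakSet i m, (t : WithTop ℤ) < level' hO x → t < α i := by
  have hend : ∀ z : D.Hyper' O i, z < x → ∃ t ∈ D.breakSet i m, level' hO z = (t : WithTop ℤ) := by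
    intro z hz
    refine ((exists_level'_eq_iff hO hm).1 ⟨z, rfl⟩).resolve_left fun h => ?_
    exact ((lt_iff_level'_lt hO hm).1 hz).ne_top h.1
  by_cases h : ∃ y : D.Hyper' O i, y < x ∧ ∀ z, z < x → ¬ y < z
  · rw [pred, dif_pos h, pointGT_coe_act_iff hO hm]
    obtain ⟨hyx, hmax⟩ := h.choose_spec
    constructor
    · intro hy t ht htx
      obtain ⟨z, hz⟩ := exists_level'_eq_coe hO hm ht
      have h1 := hmax z ((lt_iff_level'_lt hO hm).2 (hz ▸ htx))
      rw [lt_iff_level'_lt hO hm, hz, not_lt] at h1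
      exact WithTop.coe_lt_coe.1 (h1.trans_lt hy)
    · intro hall
      obtain ⟨t, ht, hyt⟩ := hend _ hyx
      rw [hyt]
      exact WithTop.coe_lt_coe.2 (hall t ht (hyt ▸ (lt_iff_level'_lt hO hm).1 hyx))
  · rw [pred, dif_neg h]
    refine iff_of_true (Or.inl rfl) fun t ht htx => absurd ?_ h
    have hbdd : ∃ u : ℤ, ∀ z, (z ∈ D.breakSet i m ∧ (z : WithTop ℤ) < level' hO x) → z ≤ u := by
      obtain ⟨-, u, hu⟩ | ⟨u, -, hu⟩ := (exists_level'_eq_iff hO hm).1 ⟨x, rfl⟩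
      · exact ⟨u, fun z hz => hu hz.1⟩
      · exact ⟨u, fun z hz => (WithTop.coe_lt_coe.1 (hu ▸ hz.2)).le⟩
    obtain ⟨s, ⟨hs, hsx⟩, hmax⟩ := Int.exists_greatest_of_bdd hbdd ⟨t, ht, htx⟩
    obtain ⟨y, hy⟩ := exists_level'_eq_coe hO hm hs
    refine ⟨y, (lt_iff_level'_lt hO hm).2 (hy ▸ hsx), fun z hz hyz => ?_⟩
    obtain ⟨r, hr, hzr⟩ := hend z hz
    rw [lt_iff_level'_lt hO hm, hy, hzr, WithTop.coe_lt_coe] at hyz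
    exact hyz.not_ge (hmax r ⟨hr, hzr ▸ (lt_iff_level'_lt hO hm).1 hz⟩)

theorem act_mem_box_iff (hO : O = Set.range fun α => D.act α m)
    (hm : ∀ α, D.act α m = m → α = 0) {α : Fin n → ℤ} {N : ∀ i, D.Hyper' O i} :
    D.act α m ∈ D.box O N ↔ ∀ i, InCell (D.breakSet i m) (α i) (level' hO (N i)) := by
  refine (and_iff_right (act_mem_orbit hO α)).trans (forall_congr' fun i => ?_)
  rw [pointGT_pred_act_iff hO hm, pointLE_act_iff hO hm, InCell]

theorem mem_box_iff (hO : O = Set.range fun α => D.act α m)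
    (hm : ∀ α, D.act α m = m → α = 0) {N : ∀ i, D.Hyper' O i} :
    m ∈ D.box O N ↔ ∀ i, InCell (D.breakSet i m) 0 (level' hO (N i)) := by
  conv_lhs => rw [← D.act_zero m]
  exact act_mem_box_iff hO hm

theorem exists_mem_box (hO : O = Set.range fun α => D.act α m)
    (hm : ∀ α, D.act α m = m → α = 0) : ∃ N, m ∈ D.box O N := by
  have h : ∀ i, ∃ x : D.Hyper' O i, InCell (D.breakSet i m) 0 (level' hO x) := by
    intro i
    obtain ⟨z, hz, hcell⟩ := exists_inCell (D.breakSet i m) 0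
    obtain ⟨x, rfl⟩ := (exists_level'_eq_iff hO hm).2 hz
    exact ⟨x, hcell⟩
  choose N hN using h
  exact ⟨N, (mem_box_iff hO hm).2 hN⟩

theorem box_nonempty (hO : O = Set.range fun α => D.act α m)
    (hm : ∀ α, D.act α m = m → α = 0) (N : ∀ i, D.Hyper' O i) : (D.box O N).Nonempty := by
  have h : ∀ i, ∃ a, InCell (D.breakSet i m) a (level' hO (N i)) := fun i =>
    ((exists_level'_eq_iff hO hm).1 ⟨N i, rfl⟩).exists_inCell
  choose α hα using h
  exact ⟨D.act α m, (act_mem_box_iff hO hm).2 hα⟩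

theorem eq_of_mem_box (hO : O = Set.range fun α => D.act α m)
    (hm : ∀ α, D.act α m = m → α = 0) {N N' : ∀ i, D.Hyper' O i} (h : m ∈ D.box O N)
    (h' : m ∈ D.box O N') : N = N' := by
  funext i
  exact level'_injective hO hm (InCell.end_unique ((exists_level'_eq_iff hO hm).1 ⟨_, rfl⟩)
    ((exists_level'_eq_iff hO hm).1 ⟨_, rfl⟩) ((mem_box_iff hO hm).1 h i)
    ((mem_box_iff hO hm).1 h' i))

theorem supp_eq_box {M : Type w} [AddCommGroup M] [Module D.B M] [IsSimpleModule D.B M]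
    (hO : O = Set.range fun α => D.act α m) (hm : ∀ α, D.act α m = m → α = 0)
    (hsub : D.supp M ⊆ O) (hsupp : m ∈ D.supp M) {N : ∀ i, D.Hyper' O i}
    (hN : m ∈ D.box O N) : D.supp M = D.box O N := by
  have h : ∀ α, D.act α m ∈ D.supp M ↔ D.act α m ∈ D.box O N := by
    intro α
    rw [D.act_mem_supp_iff hm hsupp, I_neg_mul_sig_smul_I_le_iff, act_mem_box_iff hO hm]
    push Not
    refine forall_congr' fun i => ?_
    rw [((mem_box_iff hO hm).1 hN i).inCell_iff ((exists_level'_eq_iff hO hm).1 ⟨_, rfl⟩)]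
    refine forall₂_congr fun t _ => ?_
    push Not
    rfl
  ext m'
  constructor
  · intro hm'
    obtain ⟨α, rfl⟩ : m' ∈ Set.range fun α => D.act α m := hO ▸ hsub hm'
    exact (h α).1 hm'
  · intro hm'
    obtain ⟨α, rfl⟩ : m' ∈ Set.range fun α => D.act α m := hO ▸ hm'.1
    exact (h α).2 hm'

theorem IsOrbit.eq_range (hO : D.IsOrbit O) {m : MaximalSpectrum R} (hm : m ∈ O) :
    O = Set.range fun α => D.act α m := by
  obtain ⟨m₀, rfl⟩ := hO
  obtain ⟨β, rfl⟩ := hm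
  ext m'
  constructor
  · rintro ⟨α, rfl⟩
    exact ⟨α - β, by simp only [← act_add, sub_add_cancel]⟩
  · rintro ⟨α, rfl⟩
    exact ⟨α + β, D.act_add α β m₀⟩

/-! ### The classification -/

theorem SimpleWeightModule.existsUnique_supp_eq_box (hO : D.IsOrbit O)
    (htf : D.IsTorsionFree O) (X : SimpleWeightModule.{u, v, w} D O) :
    ∃! N : ∀ i, D.Hyper' O i, D.supp X.M = D.box O N := by
  have := X.simple
  have := IsSimpleModule.nontrivial D.B X.M
  obtain ⟨m, hm⟩ := D.supp_nonempty X.weight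
  have hmO := X.supp_subset hm
  obtain ⟨N, hN⟩ := exists_mem_box (hO.eq_range hmO) (htf m hmO)
  refine ⟨N, supp_eq_box (hO.eq_range hmO) (htf m hmO) X.supp_subset hm hN, fun N' hN' => ?_⟩
  exact eq_of_mem_box (hO.eq_range hmO) (htf m hmO) (hN' ▸ hm) hN

theorem SimpleWeightModule.equiv_of_supp_eq_box (hO : D.IsOrbit O) (htf : D.IsTorsionFree O)
    {X Y : SimpleWeightModule.{u, v, w} D O} {N : ∀ i, D.Hyper' O i}
    (hX : D.supp X.M = D.box O N) (hY : D.supp Y.M = D.box O N) : X ≈ Y := by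
  have := X.simple
  have := Y.simple
  obtain ⟨m₀, hm₀⟩ : O.Nonempty := by
    obtain ⟨m₀, rfl⟩ := hO
    exact ⟨_, 0, rfl⟩
  obtain ⟨m, hm⟩ := box_nonempty (hO.eq_range hm₀) (htf m₀ hm₀) N
  obtain ⟨e⟩ := D.nonempty_linearEquiv_quotient (htf m hm.1) (hX ▸ hm)
  obtain ⟨f⟩ := D.nonempty_linearEquiv_quotient (htf m hm.1) (hY ▸ hm)
  exact ⟨e.trans f.symm⟩

theorem SimpleWeightModule.exists_supp_eq_box (hO : D.IsOrbit O) (htf : D.IsTorsionFree O)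
    (N : ∀ i, D.Hyper' O i) :
    ∃ X : SimpleWeightModule.{u, v, max v w} D O, D.supp X.M = D.box O N := by
  obtain ⟨m₀, hm₀⟩ : O.Nonempty := by
    obtain ⟨m₀, rfl⟩ := hO
    exact ⟨_, 0, rfl⟩
  obtain ⟨m, hm⟩ := box_nonempty (hO.eq_range hm₀) (htf m₀ hm₀) N
  obtain ⟨X, hX⟩ := D.exists_simpleWeightModule (hO.eq_range hm.1) (htf m hm.1)
  have := X.simple
  exact ⟨X, supp_eq_box (hO.eq_range hm.1) (htf m hm.1) X.supp_subset hX hm⟩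

theorem supp_congr {M N : Type w} [AddCommGroup M] [Module D.B M] [AddCommGroup N]
    [Module D.B N] (e : M ≃ₗ[D.B] N) : D.supp M = D.supp N := by
  have key : ∀ {M N : Type w} [AddCommGroup M] [Module D.B M] [AddCommGroup N] [Module D.B N],
      (M ≃ₗ[D.B] N) → D.supp M ⊆ D.supp N := by
    intro M N _ _ _ _ e m hm hbot
    obtain ⟨x, hx, hx0⟩ := D.exists_ne_zero_of_mem_supp hm
    have hex : e x ∈ D.weightSpace N m := fun r hr => by rw [← map_smul, hx r hr, map_zero]
    rw [hbot, AddSubgroup.mem_bot, e.map_eq_zero_iff] at hex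
    exact hx0 hex
  exact (key e).antisymm (key e.symm)

end BRDatum

theorem mainTheorem1 {k : Type u} [Field k] {R : Type v} [CommRing R] [Algebra k R] {n : ℕ}
    (hn : 0 < n) (D : BRDatum k R n) (O : Set (MaximalSpectrum R)) (hO : D.IsOrbit O)
    (htf : D.IsTorsionFree O) :
    ∃ Φ : BRDatum.SimpleIsoClass.{u, v, max v w} D O ≃ (∀ i, D.Hyper' O i),
      ∀ (X : BRDatum.SimpleWeightModule.{u, v, max v w} D O) (N : ∀ i, D.Hyper' O i),
        D.supp X.M = D.box O N ↔ N = Φ (Quotient.mk (D.isoSetoid O) X) := by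
  choose F hF huniq using fun X : BRDatum.SimpleWeightModule.{u, v, max v w} D O =>
    X.existsUnique_supp_eq_box hO htf
  have hcongr : ∀ X Y : BRDatum.SimpleWeightModule.{u, v, max v w} D O, X ≈ Y → F X = F Y :=
    fun X Y ⟨e⟩ => huniq Y _ ((BRDatum.supp_congr e).symm.trans (hF X))
  have hbij : Function.Bijective (Quotient.lift F hcongr) := by
    constructor
    · intro a b h
      induction a, b using Quotient.inductionOn₂ with | _ X Y
      exact Quotient.sound (BRDatum.SimpleWeightModule.equiv_of_supp_eq_box hO htf (hF X)
        ((hF Y).trans (congrArg (D.box O) (Eq.symm h))))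
    · intro N
      obtain ⟨X, hX⟩ := BRDatum.SimpleWeightModule.exists_supp_eq_box.{u, v, w} hO htf N
      exact ⟨Quotient.mk _ X, (huniq X N hX).symm⟩
  exact ⟨Equiv.ofBijective _ hbij, fun X N => ⟨huniq X N, fun h => h ▸ hF X⟩⟩
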